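/- For a Coxeter graph $\Gamma$ of finite (spherical) type with vertex set $S$, let $A_\Gamma$ be the associated Artin--Tits group with standard generators $S$, and let $\Delta_\Gamma\in A_\Gamma$ be the lift of the longest element of the Coxeter group $W_\Gamma$, i.e. the element represented by any reduced expression of the longest element. Let $X_P(\Gamma)\subset A_\Gamma$ be the union of the proper irreducible standard parabolic subgroups (the subgroups generated by those nonempty proper subsets of $S$ which span a connected subgraph of $\Gamma$) and of the cyclic subgroup generated by $\Delta_\Gamma^2$. For a subset $X$ of a group $G$, let $\mathrm{Cay}(G,X)$ be the graph with vertex set $G$ in which two distinct elements $x,y$ are adjacent if and only if $x^{-1}y\in X$ or $y^{-1}x\in X$, with its path metric. Let $\sigma_1,\dots,\sigma_n$ be the standard generators of $A_{A_n}$ (the braid group on $n+1$ strands) and $\tau_1,\dots,\tau_n$ those of $A_{B_n}$, numbered along the Coxeter graph so that the edge labelled $4$ joins $\tau_1$ and $\tau_2$. Let $n\geq 3$. The homomorphism $\eta_n: A_{B_n}\to A_{A_n}$ given by $\tau_1\mapsto \sigma_1^2$ and $\tau_i\mapsto\sigma_i$ for $2\leq i\leq n$ is injective, and its image is the subgroup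 of $1$-pure braids, that is, the braids on $n+1$ strands whose first strand ends in the first position. The graphs $\mathrm{Cay}(A_{B_n},X_P(B_n))$ and $\mathrm{Cay}(A_{A_n},X_P(A_n))$ are connected, and the map $\eta_n$ on vertices is a quasi-isometry between them: there are constants $K\geq 1$, $C\geq 0$ such that $$\tfrac1K\, d(x,y)-C\ \leq\ d(\eta_n(x),\eta_n(y))\ \leq\ K\, d(x,y)+C\qquad\text{for all } x,y\in A_{B_n},$$ and every element of $A_{A_n}$ is at distance at most $C$ from $\eta_n(A_{B_n})$. -/

import Mathlib

namespace ArtinTits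

section General

variable {B : Type*} (M : CoxeterMatrix B)

/-- The Artin-Tits relators: for all `i`, `j`, the two alternating words of length `M i j` in the
letters `i`, `j` are identified. (The label `∞` is encoded by `M i j = 0`; then both words are
empty and there is no relation. For `i = j` the relator is trivial too.) -/
def relators : Set (FreeGroup B) :=
  {r | ∃ i j : B,
    r = ((CoxeterSystem.alternatingWord i j (M i j)).map FreeGroup.of).prod *
      (((CoxeterSystem.alternatingWord j i (M i j)).map FreeGroup.of).prod)⁻¹}

/-- The Artin-Tits group of a Coxeter matrix. -/
abbrev ArtinGroup : Type _ := PresentedGroup (relators M)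

/-- The standard generators of the Artin-Tits group. -/
def gen (i : B) : ArtinGroup M := PresentedGroup.of i

/-- The element of the Artin-Tits group represented by a positive word. -/
def wordLift (w : List B) : ArtinGroup M := (w.map (gen M)).prod

theorem gen_relation (i j : B) :
    wordLift M (CoxeterSystem.alternatingWord i j (M i j)) =
      wordLift M (CoxeterSystem.alternatingWord j i (M i j)) := by
  have h := PresentedGroup.one_of_mem (rels := relators M)
    (x := ((CoxeterSystem.alternatingWord i j (M i j)).map FreeGroup.of).prod *
      (((CoxeterSystem.alternatingWord j i (M i j)).map FreeGroup.of).prod)⁻¹) ⟨i, j, rfl⟩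
  rw [map_mul, map_inv, mul_inv_eq_one, map_list_prod, map_list_prod, List.map_map,
    List.map_map] at h
  exact h

/-- The universal property of the Artin-Tits group. -/
def lift {G : Type*} [Group G] (f : B → G)
    (hf : ∀ i j, ((CoxeterSystem.alternatingWord i j (M i j)).map f).prod =
      ((CoxeterSystem.alternatingWord j i (M i j)).map f).prod) : ArtinGroup M →* G :=
  PresentedGroup.toGroup (f := f) (by
    rintro r ⟨i, j, rfl⟩
    rw [map_mul, map_inv, mul_inv_eq_one, map_list_prod, map_list_prod, List.map_map,
      List.map_map]
    simpa [Function.comp_def] using hf i j)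

@[simp]
theorem lift_gen {G : Type*} [Group G] (f : B → G)
    (hf : ∀ i j, ((CoxeterSystem.alternatingWord i j (M i j)).map f).prod =
      ((CoxeterSystem.alternatingWord j i (M i j)).map f).prod) (i : B) :
    lift M f hf (gen M i) = f i :=
  PresentedGroup.toGroup.of _

/-- The standard parabolic subgroup generated by the standard generators in `I`. -/
def parabolic (I : Set B) : Subgroup (ArtinGroup M) := Subgroup.closure (gen M '' I)

/-- The Coxeter graph: `i` and `j` are joined when their label is not `2`. -/
def coxeterGraph : SimpleGraph B where
  Adj i j := i ≠ j ∧ M i j ≠ 2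
  symm := ⟨fun i j h => ⟨h.1.symm, by rw [M.symmetric]; exact h.2⟩⟩
  loopless := ⟨fun _ h => h.1 rfl⟩

/-- `I` is a nonempty proper set of generators spanning a connected subgraph of the Coxeter graph,
i.e. the standard parabolic subgroup generated by `I` is proper and irreducible. -/
def IsProperIrreducible (I : Set B) : Prop :=
  I ≠ Set.univ ∧ ((coxeterGraph M).induce I).Connected

/-- `D` is the lift to the Artin-Tits group of a longest element of the Coxeter group: the element
represented by a reduced expression of a longest element. When the Coxeter group is finite, there
is exactly one such `D`, the element `Δ`, since the longest element is unique and all reduced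
expressions of an element have the same lift. -/
def IsDelta (D : ArtinGroup M) : Prop :=
  ∃ w : List B, M.toCoxeterSystem.IsReduced w ∧
    (∀ v : M.Group, M.toCoxeterSystem.length v ≤
      M.toCoxeterSystem.length (M.toCoxeterSystem.wordProd w)) ∧
    D = wordLift M w

/-- The union of the proper irreducible standard parabolic subgroups and of the cyclic subgroup
generated by `Δ ^ 2`. -/
def XP : Set (ArtinGroup M) :=
  {g | (∃ I : Set B, IsProperIrreducible M I ∧ g ∈ parabolic M I) ∨
    ∃ D : ArtinGroup M, IsDelta M D ∧ g ∈ Subgroup.zpowers (D ^ 2)}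

end General

/-- A map `f` between the vertex sets of two graphs is a quasi-isometry for the path metrics.
The distances take values in `ℕ∞` (being `⊤` between distinct components); the second condition is
`d(x, y) / K - C ≤ d(f x, f y)`, and the third says that `f` is coarsely surjective. Integer
constants are no restriction, since larger constants are allowed. -/
def IsQuasiIsometry {V W : Type*} (G : SimpleGraph V) (H : SimpleGraph W) (f : V → W) : Prop :=
  ∃ K C : ℕ, 1 ≤ K ∧
    (∀ x y, H.edist (f x) (f y) ≤ K * G.edist x y + C) ∧
    (∀ x y, G.edist x y ≤ K * (H.edist (f x) (f y) + C)) ∧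
    ∀ z, ∃ x, H.edist z (f x) ≤ C

section TypesAB

variable (n : ℕ)

/-- The Coxeter matrix of type `Bₙ`, with generators numbered so that the label `4` is between the
first two. -/
def typeB : CoxeterMatrix (Fin n) where
  M := Matrix.of fun i j : Fin n =>
    if i = j then 1
      else if (i : ℕ) + (j : ℕ) = 1 then 4
        else if (j : ℕ) + 1 = i ∨ (i : ℕ) + 1 = j then 3 else 2
  isSymm := by
    ext i j
    simp only [Matrix.transpose_apply, Matrix.of_apply]
    grind
  diagonal := by simp
  off_diagonal := by
    intro i j h
    simp only [Matrix.of_apply]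
    grind

/-- The matrix `typeB n` is Mathlib's matrix of type `Bₙ` with the numbering reversed. -/
theorem typeB_eq_reindex : typeB n = (CoxeterMatrix.B n).reindex Fin.revPerm := by
  ext i j
  have hi := i.isLt
  have hj := j.isLt
  rw [CoxeterMatrix.reindex_apply]
  simp only [typeB, CoxeterMatrix.B, Matrix.of_apply, Fin.revPerm_symm, Fin.revPerm_apply,
    Fin.val_rev, Fin.ext_iff]
  split_ifs <;> omega

/-- The Artin-Tits group of type `Aₙ`, i.e. the braid group on `n + 1` strands; its standard
generators are `σ₁, …, σₙ` with `σ_{i+1} = gen _ i`. -/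
abbrev ArtinA : Type := ArtinGroup (CoxeterMatrix.A n)

/-- The Artin-Tits group of type `Bₙ`; its standard generators are `τ₁, …, τₙ` with
`τ_{i+1} = gen _ i`. -/
abbrev ArtinB : Type := ArtinGroup (typeB n)

/-- The images of the generators `τᵢ`: `τ₁ ↦ σ₁²` and `τᵢ ↦ σᵢ` for `i ≥ 2`. -/
def etaGen (i : Fin n) : ArtinA n :=
  if (i : ℕ) = 0 then gen (CoxeterMatrix.A n) i ^ 2 else gen (CoxeterMatrix.A n) i

theorem gen_comm {i j : Fin n} (hij : i ≠ j) (h : (j : ℕ) + 1 ≠ i) (h' : (i : ℕ) + 1 ≠ j) :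
    gen (CoxeterMatrix.A n) i * gen (CoxeterMatrix.A n) j =
      gen (CoxeterMatrix.A n) j * gen (CoxeterMatrix.A n) i := by
  have hM : (CoxeterMatrix.A n) i j = 2 := by simp [CoxeterMatrix.A, hij, h, h']
  have := gen_relation (CoxeterMatrix.A n) i j
  rw [hM] at this
  simpa [wordLift, CoxeterSystem.alternatingWord] using this

theorem gen_braid {i j : Fin n} (h : (i : ℕ) + 1 = j ∨ (j : ℕ) + 1 = i) :
    gen (CoxeterMatrix.A n) i * gen (CoxeterMatrix.A n) j * gen (CoxeterMatrix.A n) i =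
      gen (CoxeterMatrix.A n) j * gen (CoxeterMatrix.A n) i * gen (CoxeterMatrix.A n) j := by
  have hij : i ≠ j := by rintro rfl; omega
  have hM : (CoxeterMatrix.A n) i j = 3 := by simp [CoxeterMatrix.A, hij, h.symm]
  have := gen_relation (CoxeterMatrix.A n) i j
  rw [hM] at this
  simpa [wordLift, CoxeterSystem.alternatingWord, mul_assoc] using this.symm

theorem braid_sq {G : Type*} [Group G] {a b : G} (h : a * b * a = b * a * b) :
    a ^ 2 * b * a ^ 2 * b = b * a ^ 2 * b * a ^ 2 := by
  have h1 : a ^ 2 * b * a ^ 2 * b = a * (a * b * a) * (a * b) := by simp only [pow_two, mul_assoc]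
  have h2 : b * a ^ 2 * b * a ^ 2 = (b * a) * (a * b * a) * a := by simp only [pow_two, mul_assoc]
  rw [h1, h2, h]
  have h3 : a * (b * a * b) * (a * b) = (a * b * a) * (b * a * b) := by group
  have h4 : b * a * (b * a * b) * a = (b * a * b) * (a * b * a) := by group
  rw [h3, h4, h]

theorem etaGen_relation (i j : Fin n) :
    ((CoxeterSystem.alternatingWord i j (typeB n i j)).map (etaGen n)).prod =
      ((CoxeterSystem.alternatingWord j i (typeB n i j)).map (etaGen n)).prod := by
  by_cases hij : i = j
  · rw [hij]
  by_cases h4 : (i : ℕ) + (j : ℕ) = 1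
  · have hM : typeB n i j = 4 := by simp [typeB, hij, h4]
    rw [hM]
    have key : ∀ i j : Fin n, (i : ℕ) = 0 → (j : ℕ) = 1 →
        etaGen n i * etaGen n j * etaGen n i * etaGen n j =
          etaGen n j * etaGen n i * etaGen n j * etaGen n i := by
      intro i j hi hj
      simp only [etaGen, hi, hj, if_true, one_ne_zero, if_false]
      exact braid_sq (gen_braid n (by omega))
    simp only [CoxeterSystem.alternatingWord, List.concat_eq_append, List.nil_append,
      List.cons_append, List.map_cons, List.map_nil, List.prod_cons, List.prod_nil, mul_one,
      ← mul_assoc]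
    rcases (by omega : ((i : ℕ) = 0 ∧ (j : ℕ) = 1) ∨ ((j : ℕ) = 0 ∧ (i : ℕ) = 1)) with h | h
    · exact key i j h.1 h.2
    · exact (key j i h.1 h.2).symm
  by_cases h3 : (j : ℕ) + 1 = i ∨ (i : ℕ) + 1 = j
  · have hM : typeB n i j = 3 := by simp [typeB, hij, h4, h3]
    rw [hM]
    have hi : (i : ℕ) ≠ 0 := by omega
    have hj : (j : ℕ) ≠ 0 := by omega
    simp only [CoxeterSystem.alternatingWord, List.concat_eq_append, List.nil_append,
      List.cons_append, List.map_cons, List.map_nil, List.prod_cons, List.prod_nil, mul_one,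
      ← mul_assoc, etaGen, hi, hj, if_false]
    exact gen_braid n h3
  · have hM : typeB n i j = 2 := by simp [typeB, hij, h4, h3]
    rw [hM]
    have hc : Commute (gen (CoxeterMatrix.A n) i) (gen (CoxeterMatrix.A n) j) :=
      gen_comm n hij (by tauto) (by tauto)
    have : Commute (etaGen n i) (etaGen n j) := by
      unfold etaGen
      split_ifs <;> simp [hc]
    simpa [CoxeterSystem.alternatingWord] using this.eq

/-- The homomorphism `ηₙ : A_{Bₙ} → A_{Aₙ}`, `τ₁ ↦ σ₁²`, `τᵢ ↦ σᵢ` for `i ≥ 2`. -/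
def eta : ArtinB n →* ArtinA n := lift (typeB n) (etaGen n) (etaGen_relation n)

/-- The transposition of `i` and `i + 1` (zero-based). -/
def adjSwap (i : Fin n) : Equiv.Perm (Fin (n + 1)) := Equiv.swap i.castSucc i.succ

theorem adjSwap_relation (i j : Fin n) :
    ((CoxeterSystem.alternatingWord i j (CoxeterMatrix.A n i j)).map (adjSwap n)).prod =
      ((CoxeterSystem.alternatingWord j i (CoxeterMatrix.A n i j)).map (adjSwap n)).prod := by
  by_cases hij : i = j
  · rw [hij]
  by_cases h3 : (j : ℕ) + 1 = i ∨ (i : ℕ) + 1 = j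
  · have hM : CoxeterMatrix.A n i j = 3 := by simp [CoxeterMatrix.A, hij, h3]
    rw [hM]
    simp only [CoxeterSystem.alternatingWord, List.concat_eq_append, List.nil_append,
      List.cons_append, List.map_cons, List.map_nil, List.prod_cons, List.prod_nil, mul_one]
    ext x
    simp only [adjSwap, Equiv.Perm.mul_apply, Equiv.swap_apply_def, Fin.ext_iff,
      Fin.val_castSucc, Fin.val_succ]
    grind
  · have hM : CoxeterMatrix.A n i j = 2 := by simp [CoxeterMatrix.A, hij, h3]
    rw [hM]
    simp only [CoxeterSystem.alternatingWord, List.concat_eq_append, List.nil_append,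
      List.cons_append, List.map_cons, List.map_nil, List.prod_cons, List.prod_nil, mul_one]
    ext x
    simp only [adjSwap, Equiv.Perm.mul_apply, Equiv.swap_apply_def, Fin.ext_iff,
      Fin.val_castSucc, Fin.val_succ]
    grind

/-- The action of the braid group on the positions of the strands, `σᵢ` acting as the
transposition `(i, i + 1)`. With Mathlib's convention (`(f * g) x = f (g x)`), the value at `y`
sends the final position of each strand of `y` to its initial position. -/
def braidPerm : ArtinA n →* Equiv.Perm (Fin (n + 1)) :=
  lift (CoxeterMatrix.A n) (adjSwap n) (adjSwap_relation n)

/-- The subgroup of 1-pure braids: the first strand ends in the first position. -/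
def onePure : Subgroup (ArtinA n) :=
  (MulAction.stabilizer (Equiv.Perm (Fin (n + 1))) (0 : Fin (n + 1))).comap (braidPerm n)

end TypesAB

end ArtinTits

/-!
The homomorphism `eta` identifies the Artin-Tits group of type `Bₙ` with the subgroup of index
`n + 1` of braids whose first strand is pure; the cosets are represented by the braids
`descend j = σ_j ⋯ σ₁`, which move the first strand to position `j` (counted from `0`).

*Injectivity and image.* A generator crosses a representative by the rule
`σ_{k+1} * descend j = descend j' * eta (cocycle k j)` (`sigma_mul_descend`), where the cocycle is an
explicit element of the group of type `B`. The rule shows at once that the cosets exhaust the braid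
group, so that the image of `eta` is the subgroup of 1-pure braids (`range_eta`). Conversely, the
formula defines permutations of the set of pairs (position, element of the group of type `B`), and
these satisfy the braid relations as a consequence of the relations of type `B` alone
(`IsBraidSeq.strandAct`). The braid group therefore acts on these pairs, and `eta b` sends `(0, 1)`
to `(0, b)` (`strandRep_eta`): this is injectivity.

*The element `Δ`.* In both types the longest element is a product of blocks: `σ_m ⋯ σ₁` in type `A`
and `τ_m ⋯ τ₁ ⋯ τ_m` in type `B`. Multiplying an initial segment of a block by a generator lengthens
it, shortens it, or pushes a smaller generator to the left. Hence the lift of any reduced word is a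
product of initial segments of blocks of the same total length (`isNormal_of_isReduced`), and the
only lift of a longest element is the product of the full blocks (`isDelta_iff`). The usual induction
for the full twist then gives `eta Δ_B = Δ_A ^ 2` (`eta_blockProd`), and this element is central
(`IsBraidSeq.commute_halfTwist_sq`).

*The quasi-isometry.* The map `eta` sends proper irreducible parabolic subgroups into such subgroups
and `Δ_B ^ 2` to `Δ_A ^ 4`, so it does not increase distances. For the reverse bound, a product of
`k` elements of `XP` of type `A` is moved step by step across the coset representatives, and it is
enough that each step costs a bounded number of elements of `XP` of type `B`
(`exists_forall_XP_mul_descend`). A proper irreducible parabolic subgroup is contained in the one of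
the first or the one of the last `n - 1` generators
(`IsProperIrreducible.subset_init_or_subset_tail`). For the first, the crossing rule restricts to the
parabolic subgroups in question or shifts one to the other; the second is conjugate to the first by
`descend n`. Powers of the full twist are central and come from powers of `Δ_B`.
-/

namespace ArtinTits

/-! ### Words in braid generators and the half twist -/

section Blocks

variable {G : Type*} [Group G] {s : ℕ → G} {n e : ℕ}

/-- The terms `s 0, …, s (n - 1)` commute when their indices differ by at least two, and
consecutive ones satisfy the braid relation from index `e` on. Thus `e = 0` is the presentation of
type `Aₙ`, and `e = 1` that of type `Bₙ` except for the relation of length four between `s 0` and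
`s 1`, which is always carried as a separate hypothesis. Values `s i` with `n ≤ i` are ignored. -/
structure IsBraidSeq (s : ℕ → G) (n e : ℕ) : Prop where
  comm : ∀ {i j : ℕ}, i + 2 ≤ j → j < n → s i * s j = s j * s i
  braid : ∀ {i : ℕ}, e ≤ i → i + 1 < n → s i * s (i + 1) * s i = s (i + 1) * s i * s (i + 1)

theorem IsBraidSeq.comm' (h : IsBraidSeq s n e) {i j : ℕ} (hij : i + 2 ≤ j ∨ j + 2 ≤ i)
    (hi : i < n) (hj : j < n) : s i * s j = s j * s i := by
  rcases hij with hij | hij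
  · exact h.comm hij hj
  · exact (h.comm hij hi).symm

/-- The product of the first `j` letters of `s m, …, s 1, s 0, s 1, …, s m`. The index
`(m - j) + (j - m)`, in truncated subtraction, is `|m - j|`. In type `A` only `j ≤ m + 1` is used,
in type `B` only `j ≤ 2 * m + 1`. -/
def block (s : ℕ → G) (m : ℕ) : ℕ → G
  | 0 => 1
  | j + 1 => block s m j * s ((m - j) + (j - m))

@[simp]
theorem block_zero (s : ℕ → G) (m : ℕ) : block s m 0 = 1 := rfl

theorem block_succ (s : ℕ → G) (m j : ℕ) :
    block s m (j + 1) = block s m j * s ((m - j) + (j - m)) := rfl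

theorem block_succ_of_le (s : ℕ → G) {m j : ℕ} (h : j ≤ m) :
    block s m (j + 1) = block s m j * s (m - j) := by
  rw [block_succ, Nat.sub_eq_zero_of_le h, add_zero]

theorem block_add_succ (s : ℕ → G) (m q : ℕ) :
    block s m (m + q + 1) = block s m (m + q) * s q := by
  rw [block_succ]
  congr 2
  omega

theorem IsBraidSeq.mul_block_of_lt (h : IsBraidSeq s n e) {m i j : ℕ} (hm : m < n)
    (hij : i + j < m) : s i * block s m j = block s m j * s i := by
  induction j with
  | zero => simp
  | succ j ih =>
    rw [block_succ_of_le s (by omega), ← mul_assoc, ih (by omega), mul_assoc, mul_assoc,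
      h.comm (by omega) (by omega)]

theorem IsBraidSeq.block_mul_of_gt (h : IsBraidSeq s n e) {m i j : ℕ} (hm : m < n) (hi : i ≤ m)
    (he : e < i) (hj : j ≤ m + 1) (hij : m + 1 < i + j) :
    block s m j * s i = s (i - 1) * block s m j := by
  induction j with
  | zero => omega
  | succ j ih =>
    by_cases hlt : m + 1 < i + j
    · rw [block_succ_of_le s (by omega), mul_assoc, h.comm (by omega) (by omega), ← mul_assoc,
        ih (by omega) hlt, mul_assoc]
    · obtain ⟨j, rfl⟩ : ∃ k, j = k + 1 := ⟨j - 1, by omega⟩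
      obtain ⟨i, rfl⟩ : ∃ k, i = k + 1 := ⟨i - 1, by omega⟩
      have h1 : m - (j + 1) = i := by omega
      have h2 : m - j = i + 1 := by omega
      rw [block_succ_of_le s (by omega), block_succ_of_le s (by omega), h1, h2,
        Nat.add_sub_cancel, mul_assoc, mul_assoc, ← mul_assoc (s (i + 1)) (s i),
        ← h.braid (by omega) (by omega)]
      simp only [← mul_assoc]
      rw [h.mul_block_of_lt hm (by omega : i + j < m)]

theorem IsBraidSeq.block_mul_of_gt_right (h : IsBraidSeq s n 1) {m i q : ℕ} (hm : m < n)
    (hi : i ≤ m) (hq : q + 1 < i) :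
    block s m (m + 1 + q) * s i = s (i - 1) * block s m (m + 1 + q) := by
  induction q with
  | zero => exact h.block_mul_of_gt hm hi (by omega) (by omega) (by omega)
  | succ q ih =>
    rw [show m + 1 + (q + 1) = m + (q + 1) + 1 by omega, block_add_succ, mul_assoc,
      h.comm (by omega) (by omega), ← mul_assoc, show m + (q + 1) = m + 1 + q by omega,
      ih (by omega), mul_assoc]

theorem IsBraidSeq.block_mul_of_lt_right (h : IsBraidSeq s n 1)
    (h4 : 1 < n → s 0 * s 1 * s 0 * s 1 = s 1 * s 0 * s 1 * s 0) {m i q : ℕ} (hm : m < n)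
    (hqm : q ≤ m) (hi : i < q) :
    block s m (m + 1 + q) * s i = s i * block s m (m + 1 + q) := by
  induction q with
  | zero => omega
  | succ q ih =>
    by_cases hlt : i < q
    · rw [show m + 1 + (q + 1) = m + (q + 1) + 1 by omega, block_add_succ, mul_assoc,
        ← h.comm (by omega) (by omega), ← mul_assoc, show m + (q + 1) = m + 1 + q by omega,
        ih (by omega) hlt, mul_assoc]
    · obtain rfl : i = q := by omega
      rcases i with _ | i
      · obtain ⟨m, rfl⟩ : ∃ k, m = k + 1 := ⟨m - 1, by omega⟩
        have e1 : block s (m + 1) (m + 1 + 1 + (0 + 1)) = block s (m + 1) m * s 1 * s 0 * s 1 := by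
          rw [show m + 1 + 1 + (0 + 1) = m + 1 + 1 + 1 by omega, block_add_succ s (m + 1) 1,
            block_succ_of_le s le_rfl, block_succ_of_le s (by omega)]
          simp
        have e2 := h.mul_block_of_lt hm (by omega : 0 + m < m + 1)
        have e3 : s 0 * (block s (m + 1) m * s 1 * s 0 * s 1)
            = block s (m + 1) m * (s 0 * s 1 * s 0 * s 1) := by
          simp only [← mul_assoc]
          rw [e2]
        rw [e1, e3, h4 (by omega)]
        simp only [mul_assoc]
      · have e1 : block s m (m + 1 + (i + 1 + 1)) =
            block s m (m + 1 + i) * s (i + 1) * s (i + 2) := by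
          rw [show m + 1 + (i + 1 + 1) = m + (i + 2) + 1 by omega, block_add_succ,
            show m + (i + 2) = m + (i + 1) + 1 by omega, block_add_succ,
            show m + (i + 1) = m + 1 + i by omega]
        have e2 := h.block_mul_of_gt_right hm (by omega : i + 2 ≤ m) (by omega : i + 1 < i + 2)
        rw [e1, mul_assoc, mul_assoc, ← mul_assoc (s (i + 1)), h.braid (by omega) (by omega),
          ← mul_assoc, ← mul_assoc, e2]
        simp [mul_assoc]

/-- In type `A`, multiplying a block by a generator on the right lengthens it, shortens it, or
can be moved to the left as a multiplication by a generator of smaller index than `m`. -/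
theorem IsBraidSeq.block_mul_trichotomy_A (h : IsBraidSeq s n 0) {m i j : ℕ} (hm : m < n)
    (hi : i ≤ m) (hj : j ≤ m + 1) :
    (j < m + 1 ∧ block s m j * s i = block s m (j + 1)) ∨
    (∃ k < j, j = k + 1 ∧ block s m j = block s m k * s i) ∨
    ∃ k < m, block s m j * s i = s k * block s m j := by
  rcases lt_trichotomy (i + j) m with hij | hij | hij
  · exact .inr (.inr ⟨i, by omega, (h.mul_block_of_lt hm hij).symm⟩)
  · refine .inl ⟨by omega, ?_⟩
    rw [block_succ_of_le s (by omega), show m - j = i by omega]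
  · rcases eq_or_ne (i + j) (m + 1) with hij' | hij'
    · obtain ⟨k, rfl⟩ : ∃ k, j = k + 1 := ⟨j - 1, by omega⟩
      refine .inr (.inl ⟨k, by omega, rfl, ?_⟩)
      rw [block_succ_of_le s (by omega), show m - k = i by omega]
    · exact .inr (.inr ⟨i - 1, by omega,
        h.block_mul_of_gt hm hi (by omega) (by omega) (by omega)⟩)

/-- The analogue in type `B` of `IsBraidSeq.block_mul_trichotomy_A`, where the blocks extend
beyond the letter `s 0`. -/
theorem IsBraidSeq.block_mul_trichotomy_B (h : IsBraidSeq s n 1)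
    (h4 : 1 < n → s 0 * s 1 * s 0 * s 1 = s 1 * s 0 * s 1 * s 0) {m i j : ℕ} (hm : m < n)
    (hi : i ≤ m) (hj : j ≤ 2 * m + 1) :
    (j < 2 * m + 1 ∧ block s m j * s i = block s m (j + 1)) ∨
    (∃ k < j, j = k + 1 ∧ block s m j = block s m k * s i) ∨
    ∃ k < m, block s m j * s i = s k * block s m j := by
  rcases le_or_gt j m with hjm | hjm
  · rcases lt_trichotomy (i + j) m with hij | hij | hij
    · exact .inr (.inr ⟨i, by omega, (h.mul_block_of_lt hm hij).symm⟩)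
    · refine .inl ⟨by omega, ?_⟩
      rw [block_succ_of_le s (by omega), show m - j = i by omega]
    · rcases eq_or_ne (i + j) (m + 1) with hij' | hij'
      · obtain ⟨k, rfl⟩ : ∃ k, j = k + 1 := ⟨j - 1, by omega⟩
        refine .inr (.inl ⟨k, by omega, rfl, ?_⟩)
        rw [block_succ_of_le s (by omega), show m - k = i by omega]
      · exact .inr (.inr ⟨i - 1, by omega,
          h.block_mul_of_gt hm hi (by omega) (by omega) (by omega)⟩)
  · obtain ⟨q, rfl⟩ := Nat.exists_eq_add_of_lt hjm
    rcases lt_trichotomy i q with hiq | rfl | hiq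
    · refine .inr (.inr ⟨i, by omega, ?_⟩)
      rw [show m + q + 1 = m + 1 + q by omega]
      exact h.block_mul_of_lt_right h4 hm (by omega) hiq
    · exact .inr (.inl ⟨m + i, by omega, rfl, block_add_succ s m i⟩)
    · rcases eq_or_ne i (q + 1) with rfl | hne
      · refine .inl ⟨by omega, ?_⟩
        rw [show m + q + 1 + 1 = m + (q + 1) + 1 by omega, block_add_succ s m (q + 1)]
        rfl
      · refine .inr (.inr ⟨i - 1, by omega, ?_⟩)
        rw [show m + q + 1 = m + 1 + q by omega]
        exact h.block_mul_of_gt_right hm hi (by omega)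

/-- The product of the full blocks of index less than `m`, the block of index `i` having length
`L i`. It represents the longest element, for `L i = i + 1` in type `A` and `L i = 2 * i + 1` in
type `B`. -/
def blockProd (s : ℕ → G) (L : ℕ → ℕ) : ℕ → G
  | 0 => 1
  | m + 1 => blockProd s L m * block s m (L m)

/-- The braid `s (j - 1) ⋯ s 1 * s 0`, which moves the strand at position `0` to position `j`.
These are the coset representatives of the image of `eta`. -/
def descend (s : ℕ → G) : ℕ → G
  | 0 => 1
  | j + 1 => s j * descend s j

theorem descend_succ (s : ℕ → G) (j : ℕ) : descend s (j + 1) = s j * descend s j := rfl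

/-- The product `s 0 * s 1 ⋯ s (j - 1)`. -/
def ascend (s : ℕ → G) : ℕ → G
  | 0 => 1
  | j + 1 => ascend s j * s j

theorem ascend_succ (s : ℕ → G) (j : ℕ) : ascend s (j + 1) = ascend s j * s j := rfl

theorem block_succ_succ (s : ℕ → G) {m j : ℕ} (hj : j ≤ m + 1) :
    block s (m + 1) (j + 1) = s (m + 1) * block s m j := by
  induction j with
  | zero => simp [block_succ]
  | succ j ih =>
    rw [block_succ_of_le s (by omega), ih (by omega), block_succ_of_le s (by omega), mul_assoc,
      show m + 1 - (j + 1) = m - j by omega]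

theorem block_eq_descend (s : ℕ → G) (m : ℕ) : block s m (m + 1) = descend s (m + 1) := by
  induction m with
  | zero => simp [block_succ, descend]
  | succ m ih => rw [block_succ_succ s le_rfl, ih, ← descend_succ]

theorem IsBraidSeq.mul_descend_of_gt (h : IsBraidSeq s n e) {j k : ℕ} (hk : k < n) (hjk : j < k) :
    s k * descend s j = descend s j * s k := by
  induction j with
  | zero => simp [descend]
  | succ j ih =>
    rw [descend, ← mul_assoc, ← h.comm (by omega) hk, mul_assoc, ih (by omega), mul_assoc]

theorem IsBraidSeq.mul_descend_of_lt (h : IsBraidSeq s n 0) {j k : ℕ} (hj : j ≤ n)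
    (hjk : k + 1 < j) : s k * descend s j = descend s j * s (k + 1) := by
  induction j with
  | zero => omega
  | succ j ih =>
    rcases eq_or_ne j (k + 1) with rfl | hne
    · rw [descend, descend]
      calc s k * (s (k + 1) * (s k * descend s k))
          = s k * s (k + 1) * s k * descend s k := by simp only [mul_assoc]
        _ = s (k + 1) * s k * (s (k + 1) * descend s k) := by
          rw [h.braid (by omega) (by omega), mul_assoc]
        _ = _ := by rw [h.mul_descend_of_gt (by omega) (by omega)]; simp only [mul_assoc]
    · rw [descend, ← mul_assoc, h.comm (by omega) (by omega), mul_assoc, ih (by omega) (by omega),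
        mul_assoc]

theorem IsBraidSeq.ascend_mul_of_gt (h : IsBraidSeq s n e) {j k : ℕ} (hk : k < n) (hjk : j < k) :
    ascend s j * s k = s k * ascend s j := by
  induction j with
  | zero => simp [ascend]
  | succ j ih =>
    rw [ascend, mul_assoc, h.comm (by omega) hk, ← mul_assoc, ih (by omega), mul_assoc]

theorem IsBraidSeq.ascend_mul_of_lt (h : IsBraidSeq s n 0) {j k : ℕ} (hj : j ≤ n)
    (hjk : k + 1 < j) : ascend s j * s k = s (k + 1) * ascend s j := by
  induction j with
  | zero => omega
  | succ j ih =>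
    rcases eq_or_ne j (k + 1) with rfl | hne
    · rw [ascend, ascend]
      calc ascend s k * s k * s (k + 1) * s k
          = ascend s k * (s k * s (k + 1) * s k) := by simp only [mul_assoc]
        _ = ascend s k * s (k + 1) * s k * s (k + 1) := by
          rw [h.braid (by omega) (by omega)]; simp only [mul_assoc]
        _ = _ := by rw [h.ascend_mul_of_gt (by omega) (by omega)]; simp only [mul_assoc]
    · rw [ascend, mul_assoc, ← h.comm (by omega) (by omega), ← mul_assoc, ih (by omega) (by omega),
        mul_assoc]

/-- The half twist on the first `m + 1` strands. -/
def halfTwist (s : ℕ → G) : ℕ → G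
  | 0 => 1
  | m + 1 => halfTwist s m * descend s (m + 1)

theorem halfTwist_eq_blockProd (s : ℕ → G) (m : ℕ) :
    halfTwist s m = blockProd s (· + 1) m := by
  induction m with
  | zero => rfl
  | succ m ih => rw [halfTwist, ih, blockProd, block_eq_descend]

theorem descend_mem_closure (s : ℕ → G) (j : ℕ) :
    descend s j ∈ Subgroup.closure (s '' {i | i < j}) := by
  induction j with
  | zero => exact one_mem _
  | succ j ih =>
    refine mul_mem (Subgroup.subset_closure ⟨j, Nat.lt_succ_self j, rfl⟩) ?_
    exact Subgroup.closure_mono (Set.image_mono fun i hi => Nat.lt_succ_of_lt hi) ih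

theorem halfTwist_mem_closure (s : ℕ → G) (m : ℕ) :
    halfTwist s m ∈ Subgroup.closure (s '' {i | i < m}) := by
  induction m with
  | zero => exact one_mem _
  | succ m ih =>
    exact mul_mem (Subgroup.closure_mono (Set.image_mono fun i hi => Nat.lt_succ_of_lt hi) ih)
      (descend_mem_closure s (m + 1))

theorem commute_of_mem_closure {S : Set G} {x y : G} (hS : ∀ a ∈ S, Commute x a)
    (hy : y ∈ Subgroup.closure S) : Commute x y :=
  (Subgroup.closure_le (Subgroup.centralizer {x})).2
    (fun a ha => Subgroup.mem_centralizer_singleton_iff.2 (hS a ha).symm.eq) hy |>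
    Subgroup.mem_centralizer_singleton_iff.1 |> fun h => (Commute.symm h)

theorem IsBraidSeq.halfTwist_mul_descend (h : IsBraidSeq s n 0) {m : ℕ} (hm : m < n) :
    halfTwist s m * descend s (m + 1) = ascend s (m + 1) * halfTwist s m := by
  induction m with
  | zero => simp [halfTwist, descend, ascend]
  | succ m ih =>
    have hc : Commute (s (m + 1)) (halfTwist s m) := by
      refine commute_of_mem_closure ?_ (halfTwist_mem_closure s m)
      rintro _ ⟨i, hi, rfl⟩
      have hi : i < m := hi
      exact (h.comm (by omega) hm).symm
    calc halfTwist s (m + 1) * descend s (m + 1 + 1)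
        = (halfTwist s m * descend s (m + 1)) * s (m + 1) * descend s (m + 1) := by
          rw [halfTwist, descend_succ s (m + 1)]; simp only [mul_assoc]
      _ = ascend s (m + 1) * (halfTwist s m * s (m + 1)) * descend s (m + 1) := by
          rw [ih (by omega)]; simp only [mul_assoc]
      _ = _ := by
          rw [← hc.eq, halfTwist, ascend_succ s (m + 1)]; simp only [mul_assoc]

/-- The full twist on `m + 2` strands is the full twist on the first `m + 1` of them times the
pure braid in which the last strand circles all the others. -/
theorem IsBraidSeq.halfTwist_succ_sq (h : IsBraidSeq s n 0) {m : ℕ} (hm : m < n) :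
    halfTwist s (m + 1) ^ 2 = halfTwist s m ^ 2 * (descend s (m + 1) * ascend s (m + 1)) := by
  have hc : Commute (descend s (m + 1) * ascend s (m + 1)) (halfTwist s m) := by
    refine commute_of_mem_closure ?_ (halfTwist_mem_closure s m)
    rintro _ ⟨i, hi, rfl⟩
    have hi : i < m := hi
    change _ * _ = _ * _
    rw [mul_assoc, h.ascend_mul_of_lt (by omega) (by omega), ← mul_assoc,
      ← h.mul_descend_of_lt (by omega) (by omega), mul_assoc]
  calc halfTwist s (m + 1) ^ 2
      = halfTwist s m * descend s (m + 1) * (halfTwist s m * descend s (m + 1)) := by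
        rw [pow_two, halfTwist]
    _ = halfTwist s m * ((descend s (m + 1) * ascend s (m + 1)) * halfTwist s m) := by
        nth_rw 2 [h.halfTwist_mul_descend hm]; simp only [mul_assoc]
    _ = _ := by rw [hc.eq, pow_two, mul_assoc]

theorem IsBraidSeq.halfTwist_mul (h : IsBraidSeq s n 0) {m i : ℕ} (hm : m ≤ n) (hi : i < m) :
    halfTwist s m * s i = s (m - 1 - i) * halfTwist s m := by
  induction m generalizing i with
  | zero => omega
  | succ m ih =>
    rcases i with _ | i
    · rcases m with _ | m
      · simp [halfTwist, descend]
      · rw [halfTwist, h.halfTwist_mul_descend (by omega), mul_assoc, ih (by omega) (by omega),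
          ← mul_assoc, h.ascend_mul_of_lt (by omega) (by omega), mul_assoc]
        rfl
    · rw [halfTwist, mul_assoc, ← h.mul_descend_of_lt hm (by omega), ← mul_assoc,
        ih (by omega) (by omega), mul_assoc, show m + 1 - 1 - (i + 1) = m - 1 - i by omega]

/-- The full twist is central: conjugation by the half twist reverses the order of the
generators. -/
theorem IsBraidSeq.commute_halfTwist_sq (h : IsBraidSeq s n 0) {i : ℕ} (hi : i < n) :
    Commute (halfTwist s n ^ 2) (s i) := by
  change _ * _ = _ * _
  rw [pow_two, mul_assoc, h.halfTwist_mul le_rfl hi, ← mul_assoc,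
    h.halfTwist_mul le_rfl (by omega), mul_assoc, show n - 1 - (n - 1 - i) = i by omega]

end Blocks

/-! ### Normal forms -/

section NormalForm

variable {G : Type*} [Group G] {s : ℕ → G} {L : ℕ → ℕ} {n : ℕ}

/-- `x` is a product of initial segments of the blocks of index `0, …, m - 1`, in this order, of
total length `k`. -/
def IsNormal (s : ℕ → G) (L : ℕ → ℕ) : ℕ → G → ℕ → Prop
  | 0, x, k => x = 1 ∧ k = 0
  | m + 1, x, k => ∃ y l j, IsNormal s L m y l ∧ j ≤ L m ∧ x = y * block s m j ∧ k = l + j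

/-- Each initial segment of a block times a generator of index at most `m` is a longer or a
shorter segment of that block, or is the same segment preceded by a generator of index less than
`m`. -/
def BlocksAbsorb (s : ℕ → G) (L : ℕ → ℕ) (n : ℕ) : Prop :=
  ∀ m i j, m < n → i ≤ m → j ≤ L m →
    (j < L m ∧ block s m j * s i = block s m (j + 1)) ∨
    (∃ k < j, j = k + 1 ∧ block s m j = block s m k * s i) ∨
    ∃ k < m, block s m j * s i = s k * block s m j

theorem isNormal_one (s : ℕ → G) (L : ℕ → ℕ) (m : ℕ) : IsNormal s L m 1 0 := by
  induction m with
  | zero => exact ⟨rfl, rfl⟩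
  | succ m ih => exact ⟨1, 0, 0, ih, Nat.zero_le _, by simp, rfl⟩

theorem isNormal_blockProd (s : ℕ → G) (L : ℕ → ℕ) (m : ℕ) :
    IsNormal s L m (blockProd s L m) (∑ i ∈ Finset.range m, L i) := by
  induction m with
  | zero => exact ⟨rfl, rfl⟩
  | succ m ih => exact ⟨_, _, _, ih, le_rfl, rfl, Finset.sum_range_succ _ _⟩

theorem IsNormal.le {m : ℕ} {x : G} {k : ℕ} (h : IsNormal s L m x k) :
    k ≤ ∑ i ∈ Finset.range m, L i := by
  induction m generalizing x k with
  | zero => simp [h.2]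
  | succ m ih =>
    obtain ⟨y, l, j, hy, hj, -, rfl⟩ := h
    rw [Finset.sum_range_succ]
    exact Nat.add_le_add (ih hy) hj

theorem IsNormal.eq_blockProd {m : ℕ} {x : G} {k : ℕ} (h : IsNormal s L m x k)
    (hk : k = ∑ i ∈ Finset.range m, L i) : x = blockProd s L m := by
  induction m generalizing x k with
  | zero => exact h.1
  | succ m ih =>
    obtain ⟨y, l, j, hy, hj, rfl, rfl⟩ := h
    rw [Finset.sum_range_succ] at hk
    have := hy.le
    rw [blockProd, ih hy (by omega), show j = L m by omega]

/-- A generator multiplied on the right of a normal form either extends it by one letter or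
repeats the last letter of some expression of it, with which it cancels in the Coxeter group. -/
theorem IsNormal.mul_gen (hs : BlocksAbsorb s L n) {m i k : ℕ} {x : G} (h : IsNormal s L m x k)
    (hm : m ≤ n) (hi : i < m) :
    IsNormal s L m (x * s i) (k + 1) ∨ ∃ y l, k = l + 1 ∧ IsNormal s L m y l ∧ x = y * s i := by
  induction m generalizing x k i with
  | zero => omega
  | succ m ih =>
    obtain ⟨y, l, j, hy, hj, rfl, rfl⟩ := h
    rcases hs m i j (by omega) (by omega) hj with ⟨hlt, h1⟩ | ⟨q, hq, rfl, h1⟩ | ⟨q, hq, h1⟩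
    · exact .inl ⟨y, l, j + 1, hy, hlt, by rw [mul_assoc, h1], by omega⟩
    · exact .inr ⟨y * block s m q, l + q, by omega, ⟨y, l, q, hy, by omega, rfl, rfl⟩,
        by rw [h1, mul_assoc]⟩
    · rcases ih hy (by omega) hq with h2 | ⟨z, p, rfl, hz, rfl⟩
      · exact .inl ⟨_, _, j, h2, hj, by rw [mul_assoc, h1, mul_assoc], by omega⟩
      · exact .inr ⟨z * block s m j, p + j, by omega, ⟨z, p, j, hz, hj, rfl, rfl⟩,
          by rw [mul_assoc, ← h1, mul_assoc]⟩

theorem map_block_apply {X : Type*} (ρ : G →* Equiv.Perm X) {b : X} {m j : ℕ}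
    (hb : ∀ i ≤ m, ρ (s i) b = b) (hj : j ≤ 2 * m + 1) : ρ (block s m j) b = b := by
  induction j with
  | zero => simp
  | succ j ih =>
    rw [block_succ, map_mul, Equiv.Perm.mul_apply, hb _ (by omega), ih (by omega)]

theorem IsNormal.map_apply {X : Type*} (ρ : G →* Equiv.Perm X) {b : X} {m k : ℕ} {x : G}
    (h : IsNormal s L m x k) (hL : ∀ m, L m ≤ 2 * m + 1) (hb : ∀ i < m, ρ (s i) b = b) :
    ρ x b = b := by
  induction m generalizing x k with
  | zero => simp [h.1]
  | succ m ih =>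
    obtain ⟨y, l, j, hy, hj, rfl, rfl⟩ := h
    rw [map_mul, Equiv.Perm.mul_apply,
      map_block_apply ρ (fun i hi => hb i (by omega)) (hj.trans (hL m)),
      ih hy fun i hi => hb i (by omega)]

/-- If `s i` with `i < m` fixes the point `b m`, and only the full block of index `m` has an
inverse carrying `b m` to where the inverse of the full block carries it, then an element with the
same action as the product of the full blocks has no normal form shorter than that product. -/
theorem IsNormal.eq_sum_of_map_eq {X : Type*} (ρ : G →* Equiv.Perm X) (b : ℕ → X)
    (hL : ∀ m, L m ≤ 2 * m + 1) (hfix : ∀ m i, m < n → i < m → ρ (s i) (b m) = b m)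
    (hfull : ∀ m j, m < n → j ≤ L m →
      (ρ (block s m j))⁻¹ (b m) = (ρ (block s m (L m)))⁻¹ (b m) → j = L m)
    {m k : ℕ} {x : G} (hm : m ≤ n) (h : IsNormal s L m x k)
    (hx : ρ x = ρ (blockProd s L m)) : k = ∑ i ∈ Finset.range m, L i := by
  induction m generalizing x k with
  | zero => simp [h.2]
  | succ m ih =>
    obtain ⟨y, l, j, hy, hj, rfl, rfl⟩ := h
    have hfix' : ∀ z q, IsNormal s L m z q → (ρ z)⁻¹ (b m) = b m := fun z q hz =>
      Equiv.Perm.inv_eq_iff_eq.2 (hz.map_apply ρ hL fun i hi => hfix m i hm hi).symm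
    obtain rfl : j = L m := by
      refine hfull m j hm hj ?_
      have h1 := congrArg (fun f : Equiv.Perm X => f⁻¹ (b m)) hx
      simpa only [blockProd, map_mul, mul_inv_rev, Equiv.Perm.mul_apply, hfix' _ _ hy,
        hfix' _ _ (isNormal_blockProd s L m)] using h1
    rw [blockProd, map_mul, map_mul] at hx
    rw [Finset.sum_range_succ, ih (by omega) hy (mul_right_cancel hx)]

end NormalForm

/-! ### Reduced words and longest elements -/

section Coxeter

variable {n : ℕ} (M : CoxeterMatrix (Fin n))

/-- The standard generators, indexed by natural numbers and extended by `1`. -/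
def genSeq (k : ℕ) : ArtinGroup M := if h : k < n then gen M ⟨k, h⟩ else 1

theorem genSeq_val (i : Fin n) : genSeq M i = gen M i := dif_pos i.isLt

theorem wordLift_append (v w : List (Fin n)) :
    wordLift M (v ++ w) = wordLift M v * wordLift M w := by
  simp [wordLift]

theorem wordLift_singleton (i : Fin n) : wordLift M [i] = gen M i := by
  simp [wordLift]

/-- The canonical projection of the Artin-Tits group onto the Coxeter group. -/
def toCoxeter : ArtinGroup M →* M.Group :=
  lift M M.toCoxeterSystem.simple fun i j => by
    have := M.toCoxeterSystem.wordProd_braidWord_eq i j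
    rwa [CoxeterSystem.braidWord, CoxeterSystem.braidWord, M.symmetric j i] at this

theorem toCoxeter_gen (i : Fin n) : toCoxeter M (gen M i) = M.toCoxeterSystem.simple i :=
  lift_gen _ _ _ _

theorem toCoxeter_wordLift (w : List (Fin n)) :
    toCoxeter M (wordLift M w) = M.toCoxeterSystem.wordProd w := by
  rw [wordLift, map_list_prod, List.map_map, CoxeterSystem.wordProd]
  congr 2

variable {M} {L : ℕ → ℕ}

theorem exists_wordLift_eq_block (hL : ∀ m, L m ≤ 2 * m + 1) {m j : ℕ} (hm : m < n)
    (hj : j ≤ L m) : ∃ w : List (Fin n), w.length = j ∧ wordLift M w = block (genSeq M) m j := by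
  induction j with
  | zero => exact ⟨[], rfl, rfl⟩
  | succ j ih =>
    obtain ⟨w, hw, hw'⟩ := ih (by omega)
    have := hL m
    have hlt : (m - j) + (j - m) < n := by omega
    refine ⟨w ++ [⟨_, hlt⟩], by simp [hw], ?_⟩
    rw [wordLift_append, hw', wordLift_singleton, block_succ, ← genSeq_val]

theorem IsNormal.exists_wordLift_eq (hL : ∀ m, L m ≤ 2 * m + 1) {m k : ℕ} {x : ArtinGroup M}
    (hm : m ≤ n) (h : IsNormal (genSeq M) L m x k) :
    ∃ w : List (Fin n), w.length = k ∧ wordLift M w = x := by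
  induction m generalizing x k with
  | zero => exact ⟨[], h.2.symm, h.1.symm⟩
  | succ m ih =>
    obtain ⟨y, l, j, hy, hj, rfl, rfl⟩ := h
    obtain ⟨v, hv, rfl⟩ := ih (by omega) hy
    obtain ⟨w, hw, hw'⟩ := exists_wordLift_eq_block (M := M) hL hm hj
    exact ⟨v ++ w, by simp [hv, hw], by rw [wordLift_append, hw']⟩

theorem IsNormal.length_toCoxeter_le (hL : ∀ m, L m ≤ 2 * m + 1) {k : ℕ} {x : ArtinGroup M}
    (h : IsNormal (genSeq M) L n x k) : M.toCoxeterSystem.length (toCoxeter M x) ≤ k := by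
  obtain ⟨w, rfl, rfl⟩ := h.exists_wordLift_eq hL le_rfl
  rw [toCoxeter_wordLift]
  exact M.toCoxeterSystem.length_wordProd_le w

/-- The lift of a reduced word has a normal form of the same length as the word: a generator that
repeats a letter would contradict reducedness in the Coxeter group. -/
theorem isNormal_of_isReduced (hL : ∀ m, L m ≤ 2 * m + 1) (hs : BlocksAbsorb (genSeq M) L n)
    (w : List (Fin n)) (hw : M.toCoxeterSystem.IsReduced w) :
    IsNormal (genSeq M) L n (wordLift M w) w.length := by
  induction w using List.reverseRecOn with
  | nil => exact isNormal_one _ _ _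
  | append_singleton w i ih =>
    have hw' : M.toCoxeterSystem.IsReduced w := by
      simpa using CoxeterSystem.IsReduced.take hw w.length
    have h := ih hw'
    rw [wordLift_append, wordLift_singleton, ← genSeq_val, List.length_append]
    rcases h.mul_gen hs le_rfl i.isLt with h1 | ⟨y, l, hl, hy, hwy⟩
    · exact h1
    · exfalso
      have h1 := hy.length_toCoxeter_le hL
      have h2 : M.toCoxeterSystem.wordProd (w ++ [i]) = toCoxeter M y := by
        rw [CoxeterSystem.wordProd_append, ← toCoxeter_wordLift, hwy, map_mul, genSeq_val,
          toCoxeter_gen, CoxeterSystem.wordProd_singleton,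
          CoxeterSystem.simple_mul_simple_cancel_right]
      rw [← h2, hw.eq, List.length_append] at h1
      simp only [List.length_singleton] at h1
      omega

/-- The product of the full blocks is the only lift of a longest element. No appeal to
Matsumoto's theorem is needed: every reduced word of maximal length has a normal form in which all
blocks are full. The action `ρ` shows that the maximal length is attained. -/
theorem isDelta_iff {X : Type*} (ρ : M.Group →* Equiv.Perm X) (b : ℕ → X)
    (hL : ∀ m, L m ≤ 2 * m + 1) (hs : BlocksAbsorb (genSeq M) L n)
    (hfix : ∀ m i, m < n → i < m → ρ (toCoxeter M (genSeq M i)) (b m) = b m)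
    (hfull : ∀ m j, m < n → j ≤ L m →
      (ρ (toCoxeter M (block (genSeq M) m j)))⁻¹ (b m) =
        (ρ (toCoxeter M (block (genSeq M) m (L m))))⁻¹ (b m) → j = L m)
    (D : ArtinGroup M) : IsDelta M D ↔ D = blockProd (genSeq M) L n := by
  have hmax : ∀ v : M.Group, M.toCoxeterSystem.length v ≤ ∑ i ∈ Finset.range n, L i := by
    intro v
    obtain ⟨w, hw, rfl⟩ := M.toCoxeterSystem.exists_isReduced v
    rw [hw.eq]
    exact (isNormal_of_isReduced hL hs w hw).le
  obtain ⟨w, hw, hwE⟩ := M.toCoxeterSystem.exists_isReduced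
    (toCoxeter M (blockProd (genSeq M) L n))
  have hN := isNormal_of_isReduced hL hs w hw
  have hlen : w.length = ∑ i ∈ Finset.range n, L i := by
    refine hN.eq_sum_of_map_eq (ρ.comp (toCoxeter M)) b hL hfix hfull le_rfl ?_
    rw [MonoidHom.comp_apply, MonoidHom.comp_apply, toCoxeter_wordLift, hwE]
  constructor
  · rintro ⟨v, hv, hvmax, rfl⟩
    have hV := isNormal_of_isReduced hL hs v hv
    refine hV.eq_blockProd (le_antisymm hV.le ?_)
    rw [← hlen, ← hw.eq, ← hv.eq]
    exact hvmax _
  · rintro rfl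
    refine ⟨w, hw, fun v => ?_, (hN.eq_blockProd hlen).symm⟩
    rw [hw.eq, hlen]
    exact hmax v

end Coxeter

/-! ### The elements `Δ` of types `A` and `B` -/

section TypesAB

variable {n : ℕ}

theorem genSeq_relation (M : CoxeterMatrix (Fin n)) {i j : ℕ} (hi : i < n) (hj : j < n) :
    ((CoxeterSystem.alternatingWord i j (M ⟨i, hi⟩ ⟨j, hj⟩)).map (genSeq M)).prod =
      ((CoxeterSystem.alternatingWord j i (M ⟨i, hi⟩ ⟨j, hj⟩)).map (genSeq M)).prod := by
  have key : ∀ (i j : Fin n) (m : ℕ),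
      ((CoxeterSystem.alternatingWord (i : ℕ) (j : ℕ) m).map (genSeq M)).prod =
        wordLift M (CoxeterSystem.alternatingWord i j m) := by
    intro i j m
    induction m generalizing i j with
    | zero => rfl
    | succ m ih =>
      rw [CoxeterSystem.alternatingWord_succ, CoxeterSystem.alternatingWord_succ,
        List.concat_eq_append, List.concat_eq_append, List.map_append, List.prod_append, ih,
        wordLift_append, wordLift_singleton, ← genSeq_val]
      simp
  rw [key ⟨i, hi⟩ ⟨j, hj⟩, key ⟨j, hj⟩ ⟨i, hi⟩, gen_relation]

variable (n)

/-- The generators of the braid group: `sigma n k` is `σ_{k+1}`. -/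
abbrev sigma (k : ℕ) : ArtinA n := genSeq (CoxeterMatrix.A n) k

/-- The generators of the Artin-Tits group of type `Bₙ`: `tau n k` is `τ_{k+1}`. -/
abbrev tau (k : ℕ) : ArtinB n := genSeq (typeB n) k

theorem isBraidSeq_sigma : IsBraidSeq (sigma n) n 0 where
  comm {i j} hij hj := by
    have hi : i < n := by omega
    have h := genSeq_relation (CoxeterMatrix.A n) hi hj
    have hM : (CoxeterMatrix.A n) ⟨i, hi⟩ ⟨j, hj⟩ = 2 := by
      simp [CoxeterMatrix.A, show i ≠ j by omega, show j + 1 ≠ i by omega,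
        show i + 1 ≠ j by omega]
    rw [hM] at h
    simpa [CoxeterSystem.alternatingWord] using h
  braid {i} _ hi := by
    have h := genSeq_relation (CoxeterMatrix.A n) (by omega : i < n) hi
    have hM : (CoxeterMatrix.A n) ⟨i, by omega⟩ ⟨i + 1, hi⟩ = 3 := by
      simp [CoxeterMatrix.A]
    rw [hM] at h
    simpa [CoxeterSystem.alternatingWord, mul_assoc] using h.symm

theorem isBraidSeq_tau : IsBraidSeq (tau n) n 1 where
  comm {i j} hij hj := by
    have hi : i < n := by omega
    have h := genSeq_relation (typeB n) hi hj
    have hM : (typeB n) ⟨i, hi⟩ ⟨j, hj⟩ = 2 := by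
      simp [typeB, show i ≠ j by omega, show j + 1 ≠ i by omega,
        show i + 1 ≠ j by omega, show i + j ≠ 1 by omega]
    rw [hM] at h
    simpa [CoxeterSystem.alternatingWord] using h
  braid {i} hi' hi := by
    have h := genSeq_relation (typeB n) (by omega : i < n) hi
    have hM : (typeB n) ⟨i, by omega⟩ ⟨i + 1, hi⟩ = 3 := by
      simp [typeB, show i + (i + 1) ≠ 1 by omega]
    rw [hM] at h
    simpa [CoxeterSystem.alternatingWord, mul_assoc] using h.symm

theorem tau_four (h1 : 1 < n) :
    tau n 0 * tau n 1 * tau n 0 * tau n 1 = tau n 1 * tau n 0 * tau n 1 * tau n 0 := by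
  have h := genSeq_relation (typeB n) (by omega : 0 < n) h1
  have hM : (typeB n) ⟨0, by omega⟩ ⟨1, h1⟩ = 4 := by simp [typeB]
  rw [hM] at h
  simpa [CoxeterSystem.alternatingWord, mul_assoc] using h

theorem swap_mul_swap_pow_three (i : ℕ) :
    (Equiv.swap i (i + 1) * Equiv.swap (i + 1) (i + 2)) ^ 3 = 1 := by
  ext x
  simp only [pow_succ, pow_zero, one_mul, Equiv.Perm.mul_apply, Equiv.swap_apply_def,
    Equiv.Perm.one_apply]
  grind

theorem swap_mul_swap_sq {i j : ℕ} (h : i + 2 ≤ j) :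
    (Equiv.swap i (i + 1) * Equiv.swap j (j + 1)) ^ 2 = 1 := by
  ext x
  simp only [pow_succ, pow_zero, one_mul, Equiv.Perm.mul_apply, Equiv.swap_apply_def,
    Equiv.Perm.one_apply]
  grind

theorem isLiftable_of_lt (M : CoxeterMatrix (Fin n)) {H : Type*} [Group H] (f : ℕ → H)
    (hsq : ∀ i, f i * f i = 1)
    (hlt : ∀ i j (hij : i < j) (hj : j < n), (f i * f j) ^ M ⟨i, hij.trans hj⟩ ⟨j, hj⟩ = 1) :
    M.IsLiftable fun i : Fin n => f i := by
  intro i j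
  rcases lt_trichotomy (i : ℕ) j with h | h | h
  · exact hlt i j h j.isLt
  · obtain rfl := Fin.ext h
    simp [hsq]
  · have := hlt j i h i.isLt
    rw [M.symmetric, ← inv_inj, ← inv_pow, mul_inv_rev, inv_eq_of_mul_eq_one_left (hsq _),
      inv_eq_of_mul_eq_one_left (hsq _), inv_one]
    exact this

theorem isLiftable_swap :
    (CoxeterMatrix.A n).IsLiftable fun i : Fin n => Equiv.swap (i : ℕ) (i + 1) := by
  refine isLiftable_of_lt n _ (fun i => Equiv.swap i (i + 1)) (fun i => Equiv.swap_mul_self _ _) ?_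
  intro i j hij hj
  rcases eq_or_ne j (i + 1) with rfl | hne
  · have hM : CoxeterMatrix.A n ⟨i, hij.trans hj⟩ ⟨i + 1, hj⟩ = 3 := by simp [CoxeterMatrix.A]
    rw [hM]
    exact swap_mul_swap_pow_three i
  · have hM : CoxeterMatrix.A n ⟨i, hij.trans hj⟩ ⟨j, hj⟩ = 2 := by
      simp [CoxeterMatrix.A, hij.ne, show j + 1 ≠ i by omega, hne.symm]
    rw [hM]
    exact swap_mul_swap_sq (by omega)

/-- The action of the Coxeter group of type `Aₙ` on the positions `0, …, n`, other natural
numbers being fixed. -/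
def permRep : (CoxeterMatrix.A n).Group →* Equiv.Perm ℕ :=
  (CoxeterMatrix.A n).toCoxeterSystem.lift ⟨_, isLiftable_swap n⟩

theorem permRep_sigma {i : ℕ} (hi : i < n) :
    permRep n (toCoxeter _ (sigma n i)) = Equiv.swap i (i + 1) := by
  have := genSeq_val (CoxeterMatrix.A n) ⟨i, hi⟩
  rw [sigma, this, toCoxeter_gen]
  exact CoxeterSystem.lift_apply_simple _ (isLiftable_swap n) ⟨i, hi⟩

/-- The generators of the group of signed permutations of `ℕ`: `signSwap 0` changes the sign of
`0`, and `signSwap (i + 1)` exchanges `i` and `i + 1`. -/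
def signSwap : ℕ → Equiv.Perm (ℕ × Bool)
  | 0 => Function.Involutive.toPerm (fun p => (p.1, p.2 ^^ decide (p.1 = 0))) fun p => by simp
  | i + 1 => Equiv.prodCongr (Equiv.swap i (i + 1)) (Equiv.refl Bool)

theorem signSwap_zero_apply (p : ℕ × Bool) :
    signSwap 0 p = (p.1, p.2 ^^ decide (p.1 = 0)) := rfl

theorem signSwap_succ_apply (i : ℕ) (p : ℕ × Bool) :
    signSwap (i + 1) p = (Equiv.swap i (i + 1) p.1, p.2) := rfl

theorem signSwap_mul_self (i : ℕ) : signSwap i * signSwap i = 1 := by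
  rcases i with _ | i
  · ext p <;> simp [signSwap_zero_apply]
  · ext p <;> simp [signSwap_succ_apply]

theorem signSwap_inv (i : ℕ) : (signSwap i)⁻¹ = signSwap i :=
  inv_eq_of_mul_eq_one_left (signSwap_mul_self i)

theorem signSwap_succ_mul_pow (i j m : ℕ) : (signSwap (i + 1) * signSwap (j + 1)) ^ m =
    Equiv.prodCongr ((Equiv.swap i (i + 1) * Equiv.swap j (j + 1)) ^ m) (Equiv.refl Bool) := by
  induction m with
  | zero => rfl
  | succ m ih => rw [pow_succ, ih, pow_succ]; rfl

theorem isLiftable_signSwap : (typeB n).IsLiftable fun i : Fin n => signSwap i := by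
  refine isLiftable_of_lt n _ signSwap signSwap_mul_self ?_
  intro i j hij hj
  obtain ⟨j, rfl⟩ : ∃ k, j = k + 1 := ⟨j - 1, by omega⟩
  rcases i with _ | i
  · rcases j with _ | j
    · have hM : typeB n ⟨0, hij.trans hj⟩ ⟨0 + 1, hj⟩ = 4 := by simp [typeB]
      rw [hM]
      ext1 ⟨k, b⟩
      rcases k with _ | _ | k <;> cases b <;>
        simp [pow_succ, signSwap_zero_apply, signSwap_succ_apply, Equiv.swap_apply_def]
    · have hM : typeB n ⟨0, hij.trans hj⟩ ⟨j + 1 + 1, hj⟩ = 2 := by simp [typeB]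
      rw [hM]
      have h0 : ∀ k, Equiv.swap (j + 1) (j + 2) k = 0 ↔ k = 0 := fun k => by
        rw [Equiv.swap_apply_eq_iff, Equiv.swap_apply_of_ne_of_ne (by omega) (by omega)]
      ext p <;> simp [pow_succ, signSwap_zero_apply, signSwap_succ_apply, h0]
  · rw [signSwap_succ_mul_pow]
    rcases eq_or_ne j (i + 1) with rfl | hne
    · have hM : typeB n ⟨i + 1, hij.trans hj⟩ ⟨i + 1 + 1, hj⟩ = 3 := by
        simp [typeB, show i + 1 + (i + 1 + 1) ≠ 1 by omega]
      rw [hM, swap_mul_swap_pow_three]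
      rfl
    · have hM : typeB n ⟨i + 1, hij.trans hj⟩ ⟨j + 1, hj⟩ = 2 := by
        simp [typeB, show i + 1 + (j + 1) ≠ 1 by omega, show i ≠ j by omega,
          show j + 1 ≠ i by omega, hne.symm]
      rw [hM, swap_mul_swap_sq (by omega)]
      rfl

/-- The action of the Coxeter group of type `Bₙ` by signed permutations. -/
def signRep : (typeB n).Group →* Equiv.Perm (ℕ × Bool) :=
  (typeB n).toCoxeterSystem.lift ⟨_, isLiftable_signSwap n⟩

theorem signRep_tau {i : ℕ} (hi : i < n) :
    signRep n (toCoxeter _ (tau n i)) = signSwap i := by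
  have := genSeq_val (typeB n) ⟨i, hi⟩
  rw [tau, this, toCoxeter_gen]
  exact CoxeterSystem.lift_apply_simple _ (isLiftable_signSwap n) ⟨i, hi⟩

theorem isDelta_A_iff (D : ArtinA n) :
    IsDelta (CoxeterMatrix.A n) D ↔ D = blockProd (sigma n) (· + 1) n := by
  -- The inverses of the successive segments of a block carry `m + 1` to `m + 1, m, …, 0`.
  have key : ∀ m j, m < n → j ≤ m + 1 →
      (permRep n (toCoxeter _ (block (sigma n) m j)))⁻¹ (m + 1) = m + 1 - j := by
    intro m j hm hj
    induction j with
    | zero => simp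
    | succ j ih =>
      rw [block_succ_of_le _ (by omega), map_mul, map_mul, mul_inv_rev, Equiv.Perm.mul_apply,
        ih (by omega), permRep_sigma n (by omega), Equiv.swap_inv,
        show m + 1 - j = m - j + 1 by omega, Equiv.swap_apply_right]
      omega
  refine isDelta_iff (permRep n) (· + 1) (fun m => by omega)
    (fun m i j hm hi hj => (isBraidSeq_sigma n).block_mul_trichotomy_A hm hi hj) ?_ ?_ D
  · intro m i hm hi
    rw [permRep_sigma n (by omega)]
    exact Equiv.swap_apply_of_ne_of_ne (by omega) (by omega)
  · intro m j hm hj h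
    rw [key m j hm hj, key m (m + 1) hm le_rfl] at h
    omega

theorem isDelta_B_iff (D : ArtinB n) :
    IsDelta (typeB n) D ↔ D = blockProd (tau n) (2 * · + 1) n := by
  -- The inverses of the successive segments of a block carry `m` to `m, …, 0`, and then to the
  -- points `0, …, m` with the opposite sign.
  have key : ∀ m j, m < n → j ≤ 2 * m + 1 →
      (signRep n (toCoxeter _ (block (tau n) m j)))⁻¹ (m, true) =
        if j ≤ m then (m - j, true) else (j - m - 1, false) := by
    intro m j hm hj
    induction j with
    | zero => simp
    | succ j ih =>
      rw [block_succ, map_mul, map_mul, mul_inv_rev, Equiv.Perm.mul_apply,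
        ih (by omega), signRep_tau n (by omega), signSwap_inv]
      rcases lt_trichotomy j m with h | rfl | h
      · rw [if_pos (by omega), if_pos (by omega),
          show m - j + (j - m) = m - j - 1 + 1 by omega, signSwap_succ_apply]
        rw [show m - j - 1 + 1 = m - j by omega, Equiv.swap_apply_right, Nat.sub_sub]
      · rw [if_pos le_rfl, if_neg (by omega), show j - j + (j - j) = 0 by omega,
          signSwap_zero_apply]
        simp
      · rw [if_neg (by omega), if_neg (by omega),
          show m - j + (j - m) = j - m - 1 + 1 by omega, signSwap_succ_apply]
        ext <;> simp
        omega
  refine isDelta_iff (signRep n) (·, true) (fun m => by omega)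
    (fun m i j hm hi hj => (isBraidSeq_tau n).block_mul_trichotomy_B (tau_four n) hm hi hj) ?_ ?_ D
  · intro m i hm hi
    rw [signRep_tau n (by omega)]
    rcases i with _ | i
    · rw [signSwap_zero_apply]
      simp
      omega
    · rw [signSwap_succ_apply, Equiv.swap_apply_of_ne_of_ne (by simp; omega) (by simp; omega)]
  · intro m j hm hj h
    rw [key m j hm hj, key m (2 * m + 1) hm le_rfl, if_neg (by omega : ¬ 2 * m + 1 ≤ m)] at h
    split_ifs at h
    · simp at h
    · simp at h
      omega

theorem eta_tau_zero : eta n (tau n 0) = sigma n 0 ^ 2 := by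
  rcases Nat.eq_zero_or_pos n with rfl | hn
  · simp [genSeq]
  · have h1 := genSeq_val (typeB n) ⟨0, hn⟩
    have h2 := genSeq_val (CoxeterMatrix.A n) ⟨0, hn⟩
    rw [tau, sigma, h1, h2, eta, lift_gen, etaGen, if_pos rfl]

theorem eta_tau_of_pos {k : ℕ} (hk : 0 < k) : eta n (tau n k) = sigma n k := by
  by_cases hn : k < n
  · have h1 := genSeq_val (typeB n) ⟨k, hn⟩
    have h2 := genSeq_val (CoxeterMatrix.A n) ⟨k, hn⟩
    rw [tau, sigma, h1, h2, eta, lift_gen, etaGen, if_neg hk.ne']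
  · simp [genSeq, hn]

theorem eta_block (m : ℕ) : eta n (block (tau n) m (2 * m + 1)) =
    descend (sigma n) (m + 1) * ascend (sigma n) (m + 1) := by
  have h1 : ∀ j ≤ m, eta n (block (tau n) m j) = block (sigma n) m j := by
    intro j hj
    induction j with
    | zero => simp
    | succ j ih =>
      rw [block_succ, map_mul, ih (by omega), block_succ, eta_tau_of_pos n (by omega)]
  have h2 : ∀ q, eta n (block (tau n) m (m + q + 1)) =
      descend (sigma n) (m + 1) * ascend (sigma n) (q + 1) := by
    intro q
    induction q with
    | zero =>
      rw [← block_eq_descend, add_zero, block_succ_of_le _ le_rfl, block_succ_of_le _ le_rfl,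
        map_mul, h1 m le_rfl, Nat.sub_self, eta_tau_zero]
      simp [ascend, pow_two, mul_assoc]
    | succ q ih =>
      rw [block_add_succ, map_mul, ← add_assoc, ih, eta_tau_of_pos n (by omega),
        ascend_succ _ (q + 1), mul_assoc]
  rw [show 2 * m + 1 = m + m + 1 by omega, h2]

/-- `eta` maps the lift of the longest element of type `B` to the full twist. -/
theorem eta_blockProd {m : ℕ} (hm : m ≤ n) :
    eta n (blockProd (tau n) (2 * · + 1) m) = halfTwist (sigma n) m ^ 2 := by
  induction m with
  | zero => simp [blockProd, halfTwist]
  | succ m ih =>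
    rw [blockProd, map_mul, ih (by omega), eta_block, (isBraidSeq_sigma n).halfTwist_succ_sq hm]

end TypesAB

/-! ### An action on strand positions with coefficients in the group of type `B` -/

section Loops

variable {H : Type*} [Group H] {t : ℕ → H} {n : ℕ}

/-- The element `t k ⋯ t 1 * t 0 * (t k ⋯ t 1)⁻¹`. In type `B`, `eta` maps it to the conjugate of
`σ_{k+1} ^ 2` by `descend k`. -/
def loop (t : ℕ → H) : ℕ → H
  | 0 => t 0
  | k + 1 => t (k + 1) * loop t k * (t (k + 1))⁻¹

theorem loop_succ (t : ℕ → H) (k : ℕ) :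
    loop t (k + 1) = t (k + 1) * loop t k * (t (k + 1))⁻¹ := rfl

theorem loop_mem_closure (t : ℕ → H) {k m : ℕ} (hk : k < m) :
    loop t k ∈ Subgroup.closure (t '' {i | i < m}) := by
  have hmem : ∀ i < m, t i ∈ Subgroup.closure (t '' {i | i < m}) :=
    fun i hi => Subgroup.subset_closure ⟨i, hi, rfl⟩
  induction k with
  | zero => exact hmem 0 hk
  | succ k ih =>
    exact mul_mem (mul_mem (hmem _ hk) (ih (by omega))) (inv_mem (hmem _ hk))

theorem IsBraidSeq.commute_loop_of_gt (h : IsBraidSeq t n 1) {k l : ℕ} (hkl : k + 2 ≤ l)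
    (hl : l < n) : Commute (t l) (loop t k) := by
  induction k with
  | zero => exact (h.comm hkl hl).symm
  | succ k ih =>
    have h1 : Commute (t l) (t (k + 1)) := (h.comm hkl hl).symm
    exact (h1.mul_right (ih (by omega))).mul_right h1.inv_right

theorem IsBraidSeq.commute_loop_of_lt (h : IsBraidSeq t n 1) {k l : ℕ} (hl : 1 ≤ l)
    (hlk : l < k) (hk : k < n) : Commute (t l) (loop t k) := by
  induction k with
  | zero => omega
  | succ k ih =>
    by_cases hlt : l < k
    · have h1 : Commute (t l) (t (k + 1)) := h.comm (by omega) hk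
      exact (h1.mul_right (ih hlt (by omega))).mul_right h1.inv_right
    · obtain ⟨k, rfl⟩ : ∃ q, k = q + 1 := ⟨k - 1, by omega⟩
      obtain rfl : l = k + 1 := by omega
      have hb := h.braid hl hk
      have hc := h.commute_loop_of_gt (le_refl (k + 2)) hk
      have e1 : t (k + 1) = MulAut.conj (t (k + 2) * t (k + 1)) (t (k + 2)) := by
        rw [MulAut.conj_apply, ← hb]
        group
      have e2 : loop t (k + 1 + 1) = MulAut.conj (t (k + 2) * t (k + 1)) (loop t k) := by
        rw [MulAut.conj_apply, loop_succ, loop_succ]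
        group
      -- Conjugation by `t (k + 2) * t (k + 1)` carries `t (k + 2)` and `loop t k`, which commute,
      -- to `t (k + 1)` and `loop t (k + 2)`.
      have e3 := hc.map (MulAut.conj (t (k + 2) * t (k + 1)))
      rwa [← e1, ← e2] at e3

/-- The relation of length four between `t 0` and `t 1` is conjugated to one between `loop t k`
and `t (k + 1)`. -/
theorem IsBraidSeq.loop_four (h : IsBraidSeq t n 1)
    (h4 : 1 < n → t 0 * t 1 * t 0 * t 1 = t 1 * t 0 * t 1 * t 0) {k : ℕ} (hk : k + 1 < n) :
    loop t k * t (k + 1) * loop t k * t (k + 1) =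
      t (k + 1) * loop t k * t (k + 1) * loop t k := by
  induction k with
  | zero => exact h4 hk
  | succ k ih =>
    have hb := h.braid (by omega : 1 ≤ k + 1) hk
    have hc : t (k + 2) * loop t k = loop t k * t (k + 2) :=
      h.commute_loop_of_gt (le_refl (k + 2)) hk
    have e1 : loop t (k + 1) = MulAut.conj (t (k + 1) * t (k + 2)) (loop t k) := by
      rw [MulAut.conj_apply, loop_succ, mul_assoc (t (k + 1)) (t (k + 2)), hc]
      group
    have e2 : t (k + 1 + 1) = MulAut.conj (t (k + 1) * t (k + 2)) (t (k + 1)) := by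
      rw [MulAut.conj_apply, hb]
      group
    generalize MulAut.conj (t (k + 1) * t (k + 2)) = φ at e1 e2
    have e3 := congrArg φ (ih (by omega))
    simpa only [map_mul, ← e1, ← e2] using e3

variable (t n) in
/-- The coefficient that `σ_{k+1}` picks up when it is moved across the coset representative
`descend j`, see `sigma_mul_descend`. The value `1` for `n < j`, where there is no
strand, is a convention. -/
def cocycle (k j : ℕ) : H :=
  if n < j ∨ j = k then 1 else if j = k + 1 then loop t k else if j < k then t k else t (k + 1)

variable (t n) in
/-- The permutation by which `σ_{k+1}` acts on pairs of a strand position and a coefficient: the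
action of the braid group by left multiplication on itself, written in terms of the cosets of the
image of `eta`. -/
def strandAct (k : ℕ) : Equiv.Perm (ℕ × H) where
  toFun p := (Equiv.swap k (k + 1) p.1, cocycle t n k p.1 * p.2)
  invFun p := (Equiv.swap k (k + 1) p.1, (cocycle t n k (Equiv.swap k (k + 1) p.1))⁻¹ * p.2)
  left_inv p := Prod.ext (by simp) (by simp)
  right_inv p := Prod.ext (by simp) (by simp)

theorem strandAct_apply (k j : ℕ) (x : H) :
    strandAct t n k (j, x) = (Equiv.swap k (k + 1) j, cocycle t n k j * x) := rfl

theorem strandAct_self (k : ℕ) (x : H) :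
    strandAct t n k (k, x) = (k + 1, x) := by
  rw [strandAct_apply, Equiv.swap_apply_left, cocycle, if_pos (.inr rfl), one_mul]

theorem strandAct_succ {k : ℕ} (hk : k < n) (x : H) :
    strandAct t n k (k + 1, x) = (k, loop t k * x) := by
  rw [strandAct_apply, Equiv.swap_apply_right, cocycle, if_neg (by omega), if_pos rfl]

theorem strandAct_of_lt {k j : ℕ} (hk : k < n) (hj : j < k) (x : H) :
    strandAct t n k (j, x) = (j, t k * x) := by
  rw [strandAct_apply, Equiv.swap_apply_of_ne_of_ne (by omega) (by omega), cocycle,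
    if_neg (by omega), if_neg (by omega), if_pos hj]

theorem strandAct_of_gt {k j : ℕ} (hj : k + 1 < j) (hjn : j ≤ n) (x : H) :
    strandAct t n k (j, x) = (j, t (k + 1) * x) := by
  rw [strandAct_apply, Equiv.swap_apply_of_ne_of_ne (by omega) (by omega), cocycle,
    if_neg (by omega), if_neg (by omega), if_neg (by omega)]

theorem strandAct_of_out {k j : ℕ} (hk : k < n) (hjn : n < j) (x : H) :
    strandAct t n k (j, x) = (j, x) := by
  rw [strandAct_apply, Equiv.swap_apply_of_ne_of_ne (by omega) (by omega), cocycle,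
    if_pos (.inl hjn), one_mul]

/-- The permutations `strandAct` satisfy the braid relations. This uses only the relations of type
`B` for the coefficients. -/
theorem IsBraidSeq.strandAct (h : IsBraidSeq t n 1)
    (h4 : 1 < n → t 0 * t 1 * t 0 * t 1 = t 1 * t 0 * t 1 * t 0) :
    IsBraidSeq (strandAct t n) n 0 where
  comm {k l} hkl hl := by
    have hk : k < n := by omega
    ext1 ⟨j, x⟩
    rw [Equiv.Perm.mul_apply, Equiv.Perm.mul_apply]
    rcases lt_or_ge n j with hj | hj
    · simp only [strandAct_of_out, hk, hl, hj]
    rcases lt_trichotomy j k with hjk | rfl | hjk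
    · rw [strandAct_of_lt hl (by omega), strandAct_of_lt hk hjk, strandAct_of_lt hk hjk,
        strandAct_of_lt hl (by omega), ← mul_assoc, ← mul_assoc, h.comm hkl hl]
    · rw [strandAct_of_lt hl (by omega), strandAct_self, strandAct_self,
        strandAct_of_lt hl (by omega)]
    rcases eq_or_ne j (k + 1) with rfl | hjk'
    · rw [strandAct_of_lt hl (by omega), strandAct_succ hk, strandAct_succ hk,
        strandAct_of_lt hl (by omega), ← mul_assoc, ← mul_assoc,
        (h.commute_loop_of_gt hkl hl).eq]
    rcases lt_trichotomy j l with hjl | rfl | hjl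
    · rw [strandAct_of_lt hl hjl, strandAct_of_gt (by omega) hj, strandAct_of_gt (by omega) hj,
        strandAct_of_lt hl hjl, ← mul_assoc, ← mul_assoc]
      rcases eq_or_ne l (k + 2) with rfl | hne
      · omega
      · rw [h.comm (by omega) hl]
    · rw [strandAct_self, strandAct_of_gt (by omega) (by omega), strandAct_of_gt (by omega) hj,
        strandAct_self]
    rcases eq_or_ne j (l + 1) with rfl | hjl'
    · rw [strandAct_succ hl, strandAct_of_gt (by omega) (by omega), strandAct_of_gt (by omega) hj,
        strandAct_succ hl, ← mul_assoc, ← mul_assoc,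
        (h.commute_loop_of_lt (by omega) (by omega : k + 1 < l) hl).eq]
    · rw [strandAct_of_gt (by omega) hj, strandAct_of_gt (by omega) hj,
        strandAct_of_gt (by omega) hj, strandAct_of_gt (by omega) hj, ← mul_assoc, ← mul_assoc,
        h.comm (by omega) (by omega)]
  braid {k} _ hk := by
    have hk' : k < n := by omega
    ext1 ⟨j, x⟩
    simp only [Equiv.Perm.mul_apply]
    rcases lt_or_ge n j with hj | hj
    · simp only [strandAct_of_out, hk, hk', hj]
    rcases lt_trichotomy j k with hjk | rfl | hjk
    · simp only [strandAct_of_lt hk' hjk, strandAct_of_lt hk (by omega : j < k + 1), ← mul_assoc]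
      rw [h.braid (by omega) hk]
    · simp only [strandAct_self, strandAct_self, strandAct_of_lt hk (Nat.lt_succ_self j),
        strandAct_of_gt (Nat.lt_succ_self (j + 1)) (by omega : j + 1 + 1 ≤ n)]
    rcases eq_or_ne j (k + 1) with rfl | hjk1
    · simp only [strandAct_succ hk', strandAct_self, strandAct_succ hk, strandAct_self,
        strandAct_of_lt hk (Nat.lt_succ_self k), loop_succ,
        strandAct_of_gt (Nat.lt_succ_self (k + 1)) (by omega : k + 1 + 1 ≤ n)]
      group
    rcases eq_or_ne j (k + 2) with rfl | hjk2
    · simp only [strandAct_of_gt (Nat.lt_succ_self (k + 1)) hj, strandAct_succ hk,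
        strandAct_succ hk', strandAct_of_lt hk (Nat.lt_succ_self k), loop_succ]
      have h1 := h.loop_four h4 hk
      have h2 : loop t k * (t (k + 1) * loop t k * (t (k + 1))⁻¹ * (t (k + 1) * x)) =
          t (k + 1) * (loop t k * (t (k + 1) * loop t k * (t (k + 1))⁻¹ * x)) := by
        calc loop t k * (t (k + 1) * loop t k * (t (k + 1))⁻¹ * (t (k + 1) * x))
            = loop t k * t (k + 1) * loop t k * t (k + 1) * ((t (k + 1))⁻¹ * x) := by group
          _ = _ := by rw [h1]; group
      rw [h2]
    · simp only [strandAct_of_gt (by omega : k + 1 < j) hj,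
        strandAct_of_gt (by omega : k + 1 + 1 < j) hj, ← mul_assoc]
      rw [h.braid (by omega) (by omega)]

end Loops

/-! ### Injectivity of `eta` -/

section Injectivity

variable {n : ℕ}

theorem IsBraidSeq.relation {K : Type*} [Group K] {f : ℕ → K} (hf : IsBraidSeq f n 0)
    (i j : Fin n) :
    ((CoxeterSystem.alternatingWord i j (CoxeterMatrix.A n i j)).map fun i : Fin n => f i).prod =
      ((CoxeterSystem.alternatingWord j i (CoxeterMatrix.A n i j)).map
        fun i : Fin n => f i).prod := by
  by_cases hij : i = j
  · rw [hij]
  by_cases h3 : (j : ℕ) + 1 = i ∨ (i : ℕ) + 1 = j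
  · have hM : CoxeterMatrix.A n i j = 3 := by simp [CoxeterMatrix.A, hij, h3]
    rw [hM]
    have hj := j.isLt
    have hi := i.isLt
    simp only [CoxeterSystem.alternatingWord, List.concat_eq_append, List.nil_append,
      List.cons_append, List.map_cons, List.map_nil, List.prod_cons, List.prod_nil, mul_one,
      ← mul_assoc]
    rcases h3 with h | h
    · rw [← h, hf.braid (Nat.zero_le _) (by omega)]
    · rw [← h, hf.braid (Nat.zero_le _) (by omega)]
  · have hM : CoxeterMatrix.A n i j = 2 := by simp [CoxeterMatrix.A, hij, h3]
    rw [hM]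
    have hne : (i : ℕ) ≠ j := fun h => hij (Fin.ext h)
    simpa [CoxeterSystem.alternatingWord] using
      hf.comm' (by omega : (i : ℕ) + 2 ≤ j ∨ (j : ℕ) + 2 ≤ i) i.isLt j.isLt

/-- The homomorphism out of the braid group given by a sequence satisfying the braid relations. -/
def liftBraid {K : Type*} [Group K] {f : ℕ → K} (hf : IsBraidSeq f n 0) : ArtinA n →* K :=
  lift (CoxeterMatrix.A n) (fun i => f i) hf.relation

theorem liftBraid_sigma {K : Type*} [Group K] {f : ℕ → K} (hf : IsBraidSeq f n 0) {k : ℕ}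
    (hk : k < n) : liftBraid hf (sigma n k) = f k := by
  rw [sigma, genSeq, dif_pos hk]
  exact lift_gen _ _ _ _

theorem closure_range_gen {B : Type*} (M : CoxeterMatrix B) :
    Subgroup.closure (Set.range (gen M)) = ⊤ :=
  PresentedGroup.closure_range_of _

variable (n) in
/-- The action of the braid group on `ℕ × ArtinB n` by `strandAct`. -/
def strandRep : ArtinA n →* Equiv.Perm (ℕ × ArtinB n) :=
  liftBraid ((isBraidSeq_tau n).strandAct (tau_four n))

theorem strandRep_sigma {k : ℕ} (hk : k < n) :
    strandRep n (sigma n k) = strandAct (tau n) n k :=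
  liftBraid_sigma _ hk

/-- Along `eta`, the position `0` is fixed and the coefficient is multiplied by the given element,
which can therefore be recovered from its image. -/
theorem strandRep_eta (b : ArtinB n) (x : ArtinB n) :
    strandRep n (eta n b) (0, x) = (0, b * x) := by
  have hb : b ∈ Subgroup.closure (Set.range (gen (typeB n))) := by
    rw [closure_range_gen]; trivial
  induction hb using Subgroup.closure_induction generalizing x with
  | mem b hb =>
    obtain ⟨⟨k, hk⟩, rfl⟩ := hb
    have h1 := genSeq_val (typeB n) ⟨k, hk⟩
    rw [← h1]
    rcases k with _ | k
    · change strandRep n (eta n (tau n 0)) (0, x) = (0, tau n 0 * x)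
      rw [eta_tau_zero, pow_two, map_mul, Equiv.Perm.mul_apply,
        strandRep_sigma hk, strandAct_self, strandAct_succ hk]
      rfl
    · change strandRep n (eta n (tau n (k + 1))) (0, x) = (0, tau n (k + 1) * x)
      rw [eta_tau_of_pos n (by omega), strandRep_sigma hk,
        strandAct_of_lt hk (by omega)]
  | one => simp
  | mul a b _ _ iha ihb => rw [map_mul, map_mul, Equiv.Perm.mul_apply, ihb, iha, mul_assoc]
  | inv a _ ih => rw [map_inv, map_inv, Equiv.Perm.inv_eq_iff_eq, ih, mul_inv_cancel_left]

theorem eta_injective : Function.Injective (eta n) := by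
  intro a b hab
  have h := strandRep_eta a 1
  rw [hab, strandRep_eta] at h
  simpa using (congrArg Prod.snd h).symm

end Injectivity

/-! ### Cosets of the image of `eta` -/

section Cosets

variable {n : ℕ}

theorem descend_mul_eta_loop {k : ℕ} (hk : k < n) :
    descend (sigma n) k * eta n (loop (tau n) k) = sigma n k * descend (sigma n) (k + 1) := by
  have h := isBraidSeq_sigma n
  induction k with
  | zero => simp [descend, loop, eta_tau_zero, pow_two]
  | succ k ih =>
    have hb := h.braid (Nat.zero_le k) hk
    have hc := h.mul_descend_of_gt hk (Nat.lt_succ_self k)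
    have hc' : descend (sigma n) k * (sigma n (k + 1))⁻¹ =
        (sigma n (k + 1))⁻¹ * descend (sigma n) k := by
      rw [eq_inv_mul_iff_mul_eq, ← mul_assoc, hc, mul_inv_cancel_right]
    rw [loop_succ, map_mul, map_mul, map_inv, eta_tau_of_pos n (by omega)]
    calc descend (sigma n) (k + 1) *
          (sigma n (k + 1) * eta n (loop (tau n) k) * (sigma n (k + 1))⁻¹)
        = sigma n k * (descend (sigma n) k * sigma n (k + 1)) * eta n (loop (tau n) k) *
            (sigma n (k + 1))⁻¹ := by rw [descend_succ]; simp only [mul_assoc]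
      _ = sigma n k * sigma n (k + 1) * (descend (sigma n) k * eta n (loop (tau n) k)) *
            (sigma n (k + 1))⁻¹ := by rw [← hc]; simp only [mul_assoc]
      _ = (sigma n k * sigma n (k + 1) * sigma n k) * sigma n k *
            (descend (sigma n) k * (sigma n (k + 1))⁻¹) := by
          rw [ih (by omega), descend_succ]; simp only [mul_assoc]
      _ = sigma n (k + 1) * (sigma n k * sigma n (k + 1) * sigma n k) * (sigma n (k + 1))⁻¹ *
            descend (sigma n) k := by rw [hc']; nth_rw 1 [hb]; simp only [mul_assoc]
      _ = sigma n (k + 1) * (sigma n (k + 1) * (sigma n k * descend (sigma n) k)) := by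
          rw [hb]; simp only [mul_assoc, mul_inv_cancel_left]
      _ = _ := by rw [descend_succ, descend_succ]

theorem sigma_mul_descend {k j : ℕ} (hk : k < n) (hj : j ≤ n) :
    sigma n k * descend (sigma n) j =
      descend (sigma n) (Equiv.swap k (k + 1) j) * eta n (cocycle (tau n) n k j) := by
  have h := isBraidSeq_sigma n
  rcases lt_trichotomy j k with hjk | rfl | hjk
  · rw [cocycle, if_neg (by omega), if_neg (by omega), if_pos hjk, eta_tau_of_pos n (by omega),
      Equiv.swap_apply_of_ne_of_ne (by omega) (by omega), h.mul_descend_of_gt hk hjk]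
  · rw [cocycle, if_pos (.inr rfl), Equiv.swap_apply_left, map_one, mul_one, descend_succ]
  rcases eq_or_ne j (k + 1) with rfl | hne
  · rw [cocycle, if_neg (by omega), if_pos rfl, Equiv.swap_apply_right, descend_mul_eta_loop hk]
  · rw [cocycle, if_neg (by omega), if_neg hne, if_neg (by omega), eta_tau_of_pos n (by omega),
      Equiv.swap_apply_of_ne_of_ne (by omega) hne, h.mul_descend_of_lt hj (by omega)]

theorem cocycle_mem_closure {H : Type*} [Group H] (t : ℕ → H) {k j m : ℕ} (hk : k < m)
    (hj : j ≤ m) : cocycle t n k j ∈ Subgroup.closure (t '' {i | i < m}) := by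
  have hmem : ∀ i < m, t i ∈ Subgroup.closure (t '' {i | i < m}) :=
    fun i hi => Subgroup.subset_closure ⟨i, hi, rfl⟩
  rw [cocycle]
  split_ifs with h1 h2 h3
  · exact one_mem _
  · exact loop_mem_closure t hk
  · exact hmem k hk
  · exact hmem (k + 1) (by omega)

/-- The set of products `descend j * eta n c`, with `j ≤ m` and `c` in the subgroup of the first `m`
generators, is stable under the subgroup of the first `m` generators of the braid group. For `m = n` this
describes all cosets of the image of `eta`; for `m = n - 1` it compares parabolic subgroups. -/
theorem exists_mul_descend_eq {m j : ℕ} (hm : m ≤ n) (hj : j ≤ m) {y : ArtinA n}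
    (hy : y ∈ Subgroup.closure (sigma n '' {i | i < m})) :
    ∃ q ≤ m, ∃ c ∈ Subgroup.closure (tau n '' {i | i < m}),
      y * descend (sigma n) j = descend (sigma n) q * eta n c := by
  have hswap : ∀ k < m, ∀ q ≤ m, Equiv.swap k (k + 1) q ≤ m := by
    intro k hk q hq
    rw [Equiv.swap_apply_def]
    split_ifs <;> omega
  induction hy using Subgroup.closure_induction_left with
  | one => exact ⟨j, hj, 1, one_mem _, by simp⟩
  | mul_left x hx y _ ih =>
    obtain ⟨k, hk, rfl⟩ := hx
    obtain ⟨q, hq, c, hc, h⟩ := ih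
    refine ⟨_, hswap k hk q hq, _, mul_mem (cocycle_mem_closure (n := n) (tau n) hk hq) hc, ?_⟩
    rw [mul_assoc, h, ← mul_assoc, sigma_mul_descend (by have : k < m := hk; omega) (by omega),
      map_mul, mul_assoc]
  | inv_mul_cancel x hx y _ ih =>
    obtain ⟨k, hk, rfl⟩ := hx
    obtain ⟨q, hq, c, hc, h⟩ := ih
    refine ⟨_, hswap k hk q hq, _,
      mul_mem (inv_mem (cocycle_mem_closure (n := n) (tau n) hk (hswap k hk q hq))) hc, ?_⟩
    have hk' : k < n := by have : k < m := hk; omega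
    have h1 := sigma_mul_descend hk' ((hswap k hk q hq).trans hm)
    rw [Equiv.swap_apply_self] at h1
    rw [mul_assoc, h, inv_mul_eq_iff_eq_mul, ← mul_assoc, h1, mul_assoc, ← map_mul,
      mul_inv_cancel_left]

theorem closure_genSeq (M : CoxeterMatrix (Fin n)) (p : ℕ → Prop) (hp : ∀ i, p i → i < n) :
    Subgroup.closure (genSeq M '' {i | p i}) = parabolic M {i | p i} := by
  rw [parabolic]
  congr 1
  ext x
  constructor
  · rintro ⟨i, hi, rfl⟩
    exact ⟨⟨i, hp i hi⟩, hi, (genSeq_val M _).symm⟩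
  · rintro ⟨i, hi, rfl⟩
    exact ⟨i, hi, genSeq_val M i⟩

theorem closure_genSeq_lt (M : CoxeterMatrix (Fin n)) :
    Subgroup.closure (genSeq M '' {i | i < n}) = ⊤ := by
  rw [closure_genSeq M (· < n) fun _ h => h, parabolic, ← closure_range_gen M]
  congr 1
  ext x
  simp

theorem exists_mul_descend_eq_top (g : ArtinA n) {j : ℕ} (hj : j ≤ n) :
    ∃ q ≤ n, ∃ c : ArtinB n, g * descend (sigma n) j = descend (sigma n) q * eta n c := by
  obtain ⟨q, hq, c, -, h⟩ := exists_mul_descend_eq (y := g) le_rfl hj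
    (by rw [closure_genSeq_lt]; trivial)
  exact ⟨q, hq, c, h⟩

theorem braidPerm_sigma (k : Fin n) : braidPerm n (sigma n k) = adjSwap n k := by
  rw [sigma, genSeq_val]
  exact lift_gen _ _ _ _

theorem braidPerm_descend {j : ℕ} (hj : j ≤ n) :
    (braidPerm n (descend (sigma n) j) 0 : ℕ) = j := by
  induction j with
  | zero => simp [descend]
  | succ j ih =>
    have h1 : braidPerm n (descend (sigma n) j) 0 = (⟨j, by omega⟩ : Fin n).castSucc :=
      Fin.ext (ih (by omega))
    have h2 := braidPerm_sigma (⟨j, by omega⟩ : Fin n)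
    rw [descend_succ, map_mul, Equiv.Perm.mul_apply, h1]
    change ((braidPerm n) (sigma n ((⟨j, by omega⟩ : Fin n) : ℕ)) _ : ℕ) = _
    rw [h2, adjSwap, Equiv.swap_apply_left]
    rfl

theorem eta_mem_onePure (b : ArtinB n) : eta n b ∈ onePure n := by
  have hb : b ∈ Subgroup.closure (Set.range (gen (typeB n))) := by
    rw [closure_range_gen]; trivial
  induction hb using Subgroup.closure_induction with
  | mem b hb =>
    obtain ⟨k, rfl⟩ := hb
    change braidPerm n (eta n (gen _ k)) 0 = 0
    rw [← genSeq_val]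
    rcases Nat.eq_zero_or_pos k with hk | hk
    · change braidPerm n (eta n (tau n k)) 0 = 0
      have h1 := braidPerm_sigma k
      rw [hk] at h1 ⊢
      rw [eta_tau_zero, map_pow, h1, pow_two, adjSwap, Equiv.swap_mul_self]
      rfl
    · change braidPerm n (eta n (tau n k)) 0 = 0
      rw [eta_tau_of_pos n hk, braidPerm_sigma, adjSwap, Equiv.swap_apply_of_ne_of_ne]
      · intro h
        have := congrArg Fin.val h
        simp at this
        omega
      · exact (Fin.succ_ne_zero k).symm
  | one => rw [map_one]; exact one_mem _
  | mul a b _ _ iha ihb => rw [map_mul]; exact mul_mem iha ihb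
  | inv a _ ih => rw [map_inv]; exact inv_mem ih

theorem eq_zero_of_descend_mul_mem_onePure {j : ℕ} (hj : j ≤ n) {b : ArtinB n}
    (h : descend (sigma n) j * eta n b ∈ onePure n) : j = 0 := by
  have h1 : descend (sigma n) j ∈ onePure n := (Subgroup.mul_mem_cancel_right _
    (eta_mem_onePure b)).1 h
  have h2 : braidPerm n (descend (sigma n) j) 0 = 0 := h1
  have h3 := braidPerm_descend hj
  rw [h2] at h3
  exact h3.symm

theorem range_eta : (eta n).range = onePure n := by
  ext x
  constructor
  · rintro ⟨b, rfl⟩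
    exact eta_mem_onePure b
  · intro hx
    obtain ⟨q, hq, c, h⟩ := exists_mul_descend_eq_top x (Nat.zero_le n)
    rw [descend, mul_one] at h
    rw [h] at hx
    obtain rfl := eq_zero_of_descend_mul_mem_onePure hq hx
    exact ⟨c, by rw [h, descend, one_mul]⟩

end Cosets

/-! ### Path metrics of Cayley graphs -/

section WordMetric

open scoped Pointwise

variable {G : Type*} [Group G] {X : Set G}

theorem exists_mem_pow_of_closure_eq_top (hinv : ∀ x ∈ X, x⁻¹ ∈ X)
    (htop : Subgroup.closure X = ⊤) (g : G) : ∃ k : ℕ, g ∈ X ^ k := by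
  have hg : g ∈ Subgroup.closure X := by rw [htop]; trivial
  induction hg using Subgroup.closure_induction_left with
  | one => exact ⟨0, by simp⟩
  | mul_left x hx y _ ih =>
    obtain ⟨k, hk⟩ := ih
    exact ⟨k + 1, by rw [pow_succ']; exact Set.mul_mem_mul hx hk⟩
  | inv_mul_cancel x hx y _ ih =>
    obtain ⟨k, hk⟩ := ih
    exact ⟨k + 1, by rw [pow_succ']; exact Set.mul_mem_mul (hinv x hx) hk⟩

theorem exists_forall_mem_pow (h1 : 1 ∈ X) (hX : ∀ g : G, ∃ k : ℕ, g ∈ X ^ k) (n : ℕ)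
    (p : ℕ → G) : ∃ K : ℕ, ∀ i ≤ n, p i ∈ X ^ K := by
  choose f hf using fun i => hX (p i)
  refine ⟨(Finset.range (n + 1)).sup f, fun i hi => ?_⟩
  exact Set.pow_right_monotone h1 (Finset.le_sup (Finset.mem_range.2 (by omega))) (hf i)

/-- The path metric of a Cayley graph is the word metric. -/
theorem edist_mulCayley_le_iff (h1 : 1 ∈ X) (hinv : ∀ x ∈ X, x⁻¹ ∈ X) {x y : G} {k : ℕ} :
    (SimpleGraph.mulCayley X).edist x y ≤ k ↔ x⁻¹ * y ∈ X ^ k := by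
  constructor
  · intro h
    have hwalk : ∀ {u v : G} (p : (SimpleGraph.mulCayley X).Walk u v),
        u⁻¹ * v ∈ X ^ p.length := by
      intro u v p
      induction p with
      | nil => simp
      | @cons u v w huv p ih =>
        rw [SimpleGraph.Walk.length_cons, pow_succ', show u⁻¹ * w = (u⁻¹ * v) * (v⁻¹ * w) by group]
        refine Set.mul_mem_mul ?_ ih
        obtain ⟨-, g, hg, rfl | rfl⟩ := (SimpleGraph.mulCayley_adj' X u v).1 huv
        · simpa using hg
        · simpa using hinv g hg
    obtain ⟨p, hp⟩ := SimpleGraph.exists_walk_of_edist_ne_top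
      (ne_top_of_le_ne_top (ENat.natCast_ne_top k) h)
    rw [← hp] at h
    exact Set.pow_right_monotone h1 (Nat.cast_le.1 h) (hwalk p)
  · intro h
    induction k generalizing y with
    | zero =>
      rw [pow_zero, Set.mem_one, inv_mul_eq_one] at h
      simp [h]
    | succ k ih =>
      rw [pow_succ] at h
      obtain ⟨a, ha, b, hb, hab⟩ := h
      have hy : y = x * a * b := by
        rw [mul_assoc, eq_comm, ← eq_inv_mul_iff_mul_eq]
        exact hab
      have h2 : (SimpleGraph.mulCayley X).edist x (x * a) ≤ k := ih (by simpa using ha)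
      have h3 : (SimpleGraph.mulCayley X).edist (x * a) y ≤ 1 := by
        rw [SimpleGraph.edist_le_one_iff_adj_or_eq, SimpleGraph.mulCayley_adj']
        by_cases hxy : x * a = y
        · exact .inr hxy
        · exact .inl ⟨hxy, b, hb, .inl hy.symm⟩
      calc (SimpleGraph.mulCayley X).edist x y
          ≤ (SimpleGraph.mulCayley X).edist x (x * a) +
            (SimpleGraph.mulCayley X).edist (x * a) y := SimpleGraph.edist_triangle
        _ ≤ k + 1 := add_le_add h2 h3
        _ = ((k + 1 : ℕ) : ℕ∞) := by push_cast; rfl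

theorem connected_mulCayley (h1 : 1 ∈ X) (hinv : ∀ x ∈ X, x⁻¹ ∈ X)
    (hX : ∀ g : G, ∃ k : ℕ, g ∈ X ^ k) : (SimpleGraph.mulCayley X).Connected := by
  have : Nonempty G := ⟨1⟩
  refine SimpleGraph.Connected.mk fun x y => ?_
  obtain ⟨k, hk⟩ := hX (x⁻¹ * y)
  exact SimpleGraph.reachable_of_edist_ne_top
    (ne_top_of_le_ne_top (ENat.natCast_ne_top k) ((edist_mulCayley_le_iff h1 hinv).2 hk))

end WordMetric

/-! ### Proper irreducible parabolic subgroups -/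

section Parabolic

variable {n : ℕ}

theorem coxeterGraph_A_adj {i j : Fin n} : (coxeterGraph (CoxeterMatrix.A n)).Adj i j ↔
    (i : ℕ) + 1 = j ∨ (j : ℕ) + 1 = i := by
  change i ≠ j ∧ CoxeterMatrix.A n i j ≠ 2 ↔ _
  simp only [CoxeterMatrix.A, Matrix.of_apply, ne_eq, Fin.ext_iff]
  grind

theorem coxeterGraph_B_eq : coxeterGraph (typeB n) = coxeterGraph (CoxeterMatrix.A n) := by
  ext i j
  rw [coxeterGraph_A_adj]
  change i ≠ j ∧ typeB n i j ≠ 2 ↔ _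
  simp only [typeB, Matrix.of_apply, ne_eq, Fin.ext_iff]
  grind

theorem isProperIrreducible_B_iff {I : Set (Fin n)} :
    IsProperIrreducible (typeB n) I ↔ IsProperIrreducible (CoxeterMatrix.A n) I := by
  rw [IsProperIrreducible, IsProperIrreducible, coxeterGraph_B_eq]

theorem connected_interval {a b : ℕ} (hab : a < b) (hb : b ≤ n) :
    ((coxeterGraph (CoxeterMatrix.A n)).induce {i : Fin n | a ≤ i ∧ (i : ℕ) < b}).Connected := by
  let base : {i : Fin n | a ≤ (i : ℕ) ∧ (i : ℕ) < b} := ⟨⟨a, by omega⟩, le_rfl, hab⟩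
  have key : ∀ d (h : a + d < b), ((coxeterGraph (CoxeterMatrix.A n)).induce
      {i : Fin n | a ≤ (i : ℕ) ∧ (i : ℕ) < b}).Reachable base
        ⟨⟨a + d, by omega⟩, Nat.le_add_right a d, h⟩ := by
    intro d
    induction d with
    | zero => intro h; exact SimpleGraph.Reachable.refl _
    | succ d ih =>
      intro h
      refine (ih (by omega)).trans (SimpleGraph.Adj.reachable ?_)
      rw [SimpleGraph.comap_adj]
      exact coxeterGraph_A_adj.2 (.inl rfl)
  refine (SimpleGraph.connected_iff_exists_forall_reachable _).2 ⟨base, ?_⟩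
  rintro ⟨⟨v, hv⟩, h1, h2⟩
  obtain ⟨d, rfl⟩ := Nat.exists_eq_add_of_le h1
  exact key d h2

theorem isProperIrreducible_init (hn : 2 ≤ n) :
    IsProperIrreducible (CoxeterMatrix.A n) {i : Fin n | (i : ℕ) < n - 1} := by
  constructor
  · intro h
    have : (⟨n - 1, by omega⟩ : Fin n) ∈ {i : Fin n | (i : ℕ) < n - 1} := by rw [h]; trivial
    exact lt_irrefl (n - 1) this
  · have hset : {i : Fin n | (i : ℕ) < n - 1} = {i : Fin n | 0 ≤ (i : ℕ) ∧ (i : ℕ) < n - 1} := by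
      simp
    rw [hset]
    exact connected_interval (by omega) (by omega)

theorem isProperIrreducible_tail (hn : 2 ≤ n) :
    IsProperIrreducible (CoxeterMatrix.A n) {i : Fin n | 1 ≤ (i : ℕ)} := by
  constructor
  · intro h
    have : (⟨0, by omega⟩ : Fin n) ∈ {i : Fin n | 1 ≤ (i : ℕ)} := by rw [h]; trivial
    exact absurd this (by simp)
  · have hset : {i : Fin n | 1 ≤ (i : ℕ)} = {i : Fin n | 1 ≤ (i : ℕ) ∧ (i : ℕ) < n} := by
      simp
    rw [hset]
    exact connected_interval hn le_rfl

/-- A connected set of generators that misses the generator `m` lies on one side of it, hence in one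
of the two intervals obtained by removing an end of the Coxeter graph. -/
theorem IsProperIrreducible.subset_init_or_subset_tail {I : Set (Fin n)}
    (hI : IsProperIrreducible (CoxeterMatrix.A n) I) :
    I ⊆ {i : Fin n | (i : ℕ) < n - 1} ∨ I ⊆ {i : Fin n | 1 ≤ (i : ℕ)} := by
  obtain ⟨m, hm⟩ := (Set.ne_univ_iff_exists_notMem I).1 hI.1
  have hne : ∀ i ∈ I, (i : ℕ) ≠ m := fun i hi h => hm (Fin.ext h ▸ hi)
  have hwalk : ∀ {u v : I} (_ : ((coxeterGraph (CoxeterMatrix.A n)).induce I).Walk u v),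
      (u : Fin n) < m → (v : Fin n) < m := by
    intro u v p
    induction p with
    | nil => exact id
    | @cons u v w huv p ih =>
      intro hu
      apply ih
      have h1 := coxeterGraph_A_adj.1 (SimpleGraph.comap_adj.1 huv)
      have h2 := hne _ v.2
      have h3 : ((u : Fin n) : ℕ) < m := hu
      change ((v : Fin n) : ℕ) < m
      change ((u : Fin n) : ℕ) + 1 = (v : Fin n) ∨ ((v : Fin n) : ℕ) + 1 = (u : Fin n) at h1
      omega
  have hmn := m.isLt
  by_cases h : ∃ a ∈ I, a < m
  · obtain ⟨a, ha, ham⟩ := h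
    refine .inl fun b hb => ?_
    obtain ⟨p⟩ := hI.2.preconnected ⟨a, ha⟩ ⟨b, hb⟩
    have : (b : ℕ) < m := hwalk p ham
    change (b : ℕ) < n - 1
    omega
  · push Not at h
    refine .inr fun b hb => ?_
    have h1 : (m : ℕ) ≤ b := h b hb
    have h2 := hne b hb
    change 1 ≤ (b : ℕ)
    omega

theorem closure_genSeq_init (M : CoxeterMatrix (Fin n)) :
    Subgroup.closure (genSeq M '' {i | i < n - 1}) =
      parabolic M {i : Fin n | (i : ℕ) < n - 1} :=
  closure_genSeq M (· < n - 1) fun i hi => by omega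

theorem parabolic_mono {B : Type*} (M : CoxeterMatrix B) {I J : Set B} (h : I ⊆ J) :
    parabolic M I ≤ parabolic M J :=
  Subgroup.closure_mono (Set.image_mono h)

theorem eta_mem_parabolic {I : Set (Fin n)} {b : ArtinB n} (hb : b ∈ parabolic (typeB n) I) :
    eta n b ∈ parabolic (CoxeterMatrix.A n) I := by
  have hle : parabolic (typeB n) I ≤ (parabolic (CoxeterMatrix.A n) I).comap (eta n) := by
    refine (Subgroup.closure_le _).2 ?_
    rintro _ ⟨i, hi, rfl⟩
    have hmem : gen (CoxeterMatrix.A n) i ∈ parabolic (CoxeterMatrix.A n) I :=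
      Subgroup.subset_closure ⟨i, hi, rfl⟩
    change eta n (gen (typeB n) i) ∈ parabolic (CoxeterMatrix.A n) I
    rw [eta, lift_gen, etaGen]
    split_ifs
    · exact pow_mem hmem 2
    · exact hmem
  exact hle hb

theorem mem_XP_of_parabolic {B : Type*} {M : CoxeterMatrix B} {I : Set B}
    (hI : IsProperIrreducible M I) {g : ArtinGroup M} (hg : g ∈ parabolic M I) : g ∈ XP M :=
  .inl ⟨I, hI, hg⟩

theorem inv_mem_XP {B : Type*} {M : CoxeterMatrix B} {g : ArtinGroup M} (hg : g ∈ XP M) :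
    g⁻¹ ∈ XP M := by
  rcases hg with ⟨I, hI, hg⟩ | ⟨D, hD, hg⟩
  · exact .inl ⟨I, hI, inv_mem hg⟩
  · exact .inr ⟨D, hD, inv_mem hg⟩

theorem one_mem_XP {M : CoxeterMatrix (Fin n)} (hn : 2 ≤ n)
    (hM : ∀ {I}, IsProperIrreducible (CoxeterMatrix.A n) I → IsProperIrreducible M I) :
    1 ∈ XP M :=
  mem_XP_of_parabolic (hM (isProperIrreducible_init hn)) (one_mem _)

theorem gen_mem_XP {M : CoxeterMatrix (Fin n)} (hn : 2 ≤ n)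
    (hM : ∀ {I}, IsProperIrreducible (CoxeterMatrix.A n) I → IsProperIrreducible M I)
    (i : Fin n) : gen M i ∈ XP M := by
  by_cases hi : (i : ℕ) < n - 1
  · exact mem_XP_of_parabolic (hM (isProperIrreducible_init hn))
      (Subgroup.subset_closure ⟨i, hi, rfl⟩)
  · exact mem_XP_of_parabolic (hM (isProperIrreducible_tail hn))
      (Subgroup.subset_closure ⟨i, by change 1 ≤ (i : ℕ); omega, rfl⟩)

theorem closure_XP {M : CoxeterMatrix (Fin n)} (hn : 2 ≤ n)
    (hM : ∀ {I}, IsProperIrreducible (CoxeterMatrix.A n) I → IsProperIrreducible M I) :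
    Subgroup.closure (XP M) = ⊤ := by
  rw [eq_top_iff, ← closure_range_gen]
  refine Subgroup.closure_mono ?_
  rintro _ ⟨i, rfl⟩
  exact gen_mem_XP hn hM i

theorem eta_mem_XP {b : ArtinB n} (hb : b ∈ XP (typeB n)) : eta n b ∈ XP (CoxeterMatrix.A n) := by
  rcases hb with ⟨I, hI, hb⟩ | ⟨D, hD, z, rfl⟩
  · exact .inl ⟨I, isProperIrreducible_B_iff.1 hI, eta_mem_parabolic hb⟩
  · refine .inr ⟨_, (isDelta_A_iff n _).2 rfl, 2 * z, ?_⟩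
    rw [(isDelta_B_iff n D).1 hD]
    simp only [map_zpow, map_pow]
    rw [eta_blockProd n le_rfl, ← halfTwist_eq_blockProd, zpow_mul]
    norm_cast

end Parabolic

/-! ### The quasi-isometry -/

section QuasiIsometry

open scoped Pointwise

variable {n : ℕ}

/-- Left multiplication by the parabolic subgroup of the first `n - 1` generators moves across each
coset representative at the cost of one generator in `XP (typeB n)`. For the last representative the
parabolic subgroup is shifted to that of the last `n - 1` generators, which avoids `τ₁`. -/
theorem init_mul_descend (hn : 2 ≤ n) {y : ArtinA n}
    (hy : y ∈ parabolic (CoxeterMatrix.A n) {i : Fin n | (i : ℕ) < n - 1}) {j : ℕ} (hj : j ≤ n) :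
    ∃ q ≤ n, ∃ c ∈ XP (typeB n), y * descend (sigma n) j = descend (sigma n) q * eta n c := by
  rcases Nat.lt_or_ge (n - 1) j with hjn | hjn
  · obtain rfl : j = n := by omega
    suffices ∃ c ∈ parabolic (typeB j) {i : Fin j | 1 ≤ (i : ℕ)},
        y * descend (sigma j) j = descend (sigma j) j * eta j c by
      obtain ⟨c, hc, h⟩ := this
      exact ⟨j, le_rfl, c, mem_XP_of_parabolic
        (isProperIrreducible_B_iff.2 (isProperIrreducible_tail hn)) hc, h⟩
    induction hy using Subgroup.closure_induction with
    | mem x hx =>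
      obtain ⟨⟨k, hk⟩, hk', rfl⟩ := hx
      have hk' : k < j - 1 := hk'
      refine ⟨tau j (k + 1), ?_, ?_⟩
      · rw [tau, genSeq, dif_pos (by omega)]
        exact Subgroup.subset_closure ⟨_, Nat.le_add_left 1 k, rfl⟩
      · rw [eta_tau_of_pos j (by omega), ← (isBraidSeq_sigma j).mul_descend_of_lt le_rfl (by omega),
          sigma, genSeq, dif_pos hk]
    | one => exact ⟨1, one_mem _, by simp⟩
    | mul a b _ _ iha ihb =>
      obtain ⟨c, hc, h⟩ := iha
      obtain ⟨d, hd, h'⟩ := ihb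
      exact ⟨c * d, mul_mem hc hd, by rw [mul_assoc, h', ← mul_assoc, h, map_mul, mul_assoc]⟩
    | inv a _ ih =>
      obtain ⟨c, hc, h⟩ := ih
      refine ⟨c⁻¹, inv_mem hc, ?_⟩
      rw [inv_mul_eq_iff_eq_mul, ← mul_assoc, h, mul_assoc, ← map_mul, mul_inv_cancel, map_one,
        mul_one]
  · rw [← closure_genSeq_init] at hy
    obtain ⟨q, hq, c, hc, h⟩ := exists_mul_descend_eq (Nat.sub_le n 1) hjn hy
    rw [closure_genSeq_init] at hc
    exact ⟨q, by omega, c, mem_XP_of_parabolic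
      (isProperIrreducible_B_iff.2 (isProperIrreducible_init hn)) hc, h⟩

theorem conj_tail_mem_init {y : ArtinA n}
    (hy : y ∈ parabolic (CoxeterMatrix.A n) {i : Fin n | 1 ≤ (i : ℕ)}) :
    descend (sigma n) n * y * (descend (sigma n) n)⁻¹ ∈
      parabolic (CoxeterMatrix.A n) {i : Fin n | (i : ℕ) < n - 1} := by
  have hle : parabolic (CoxeterMatrix.A n) {i : Fin n | 1 ≤ (i : ℕ)} ≤
      (parabolic (CoxeterMatrix.A n) {i : Fin n | (i : ℕ) < n - 1}).comap
        (MulAut.conj (descend (sigma n) n)).toMonoidHom := by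
    refine (Subgroup.closure_le _).2 ?_
    rintro _ ⟨⟨k, hk⟩, hk', rfl⟩
    obtain ⟨k, rfl⟩ : ∃ i, k = i + 1 := ⟨k - 1, by have : 1 ≤ k := hk'; omega⟩
    change descend (sigma n) n * gen _ ⟨k + 1, hk⟩ * (descend (sigma n) n)⁻¹ ∈ parabolic _ _
    have h1 : gen (CoxeterMatrix.A n) ⟨k + 1, hk⟩ = sigma n (k + 1) :=
      (genSeq_val _ ⟨k + 1, hk⟩).symm
    rw [h1, ← (isBraidSeq_sigma n).mul_descend_of_lt le_rfl hk, mul_inv_cancel_right, sigma,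
      genSeq, dif_pos (by omega)]
    exact Subgroup.subset_closure ⟨_, by change k < n - 1; omega, rfl⟩
  exact hle hy

/-- Every element of `XP` of type `A` moves across the coset representatives at bounded cost. -/
theorem exists_forall_XP_mul_descend (hn : 2 ≤ n) :
    ∃ K : ℕ, 1 ≤ K ∧ ∀ y ∈ XP (CoxeterMatrix.A n), ∀ j ≤ n, ∃ q ≤ n, ∃ c ∈ XP (typeB n) ^ K,
      y * descend (sigma n) j = descend (sigma n) q * eta n c := by
  have h1 := one_mem_XP (M := typeB n) hn isProperIrreducible_B_iff.2
  have hX := exists_mem_pow_of_closure_eq_top (X := XP (typeB n)) (fun x hx => inv_mem_XP hx)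
    (closure_XP hn isProperIrreducible_B_iff.2)
  have hmono : ∀ {a b : ℕ}, a ≤ b → XP (typeB n) ^ a ⊆ XP (typeB n) ^ b :=
    fun h => Set.pow_right_monotone h1 h
  have hchoose : ∀ g : ArtinA n, ∃ (q : ℕ → ℕ) (c : ℕ → ArtinB n), ∀ j ≤ n, q j ≤ n ∧
      g * descend (sigma n) j = descend (sigma n) (q j) * eta n (c j) := by
    intro g
    have : ∀ j, ∃ q, ∃ c : ArtinB n, j ≤ n → q ≤ n ∧
        g * descend (sigma n) j = descend (sigma n) q * eta n c := by
      intro j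
      by_cases hj : j ≤ n
      · obtain ⟨q, hq, c, h⟩ := exists_mul_descend_eq_top g hj
        exact ⟨q, c, fun _ => ⟨hq, h⟩⟩
      · exact ⟨0, 1, fun h => absurd h hj⟩
    choose q c h using this
    exact ⟨q, c, h⟩
  obtain ⟨q₁, c₁, hc₁⟩ := hchoose (descend (sigma n) n)
  obtain ⟨q₂, c₂, hc₂⟩ := hchoose (descend (sigma n) n)⁻¹
  obtain ⟨K₁, hK₁⟩ := exists_forall_mem_pow h1 hX n c₁
  obtain ⟨K₂, hK₂⟩ := exists_forall_mem_pow h1 hX n c₂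
  obtain ⟨K₃, hK₃⟩ := hX (blockProd (tau n) (2 * · + 1) n)
  refine ⟨K₂ + 1 + K₁ + K₃, by omega, fun y hy j hj => ?_⟩
  rcases hy with ⟨I, hI, hy⟩ | ⟨D, hD, z, rfl⟩
  · rcases hI.subset_init_or_subset_tail with hsub | hsub
    · obtain ⟨q, hq, c, hc, h⟩ := init_mul_descend hn (parabolic_mono _ hsub hy) hj
      exact ⟨q, hq, c, hmono (by omega : 1 ≤ _) (by simpa using hc), h⟩
    -- Conjugation by `descend n` shifts the last `n - 1` generators to the first `n - 1`; crossing
    -- the conjugating elements costs one of finitely many coefficients.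
    · have hy' := conj_tail_mem_init (parabolic_mono _ hsub hy)
      obtain ⟨hq₁, e₁⟩ := hc₁ j hj
      obtain ⟨q, hq, c, hc, e⟩ := init_mul_descend hn hy' hq₁
      obtain ⟨hq₂, e₂⟩ := hc₂ q hq
      refine ⟨_, hq₂, c₂ q * c * c₁ j, ?_, ?_⟩
      · refine hmono (by omega : K₂ + 1 + K₁ ≤ _) ?_
        rw [pow_add, pow_add, pow_one]
        exact Set.mul_mem_mul (Set.mul_mem_mul (hK₂ q hq) hc) (hK₁ j hj)
      · calc y * descend (sigma n) j
            = (descend (sigma n) n)⁻¹ * ((descend (sigma n) n * y * (descend (sigma n) n)⁻¹) *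
                (descend (sigma n) n * descend (sigma n) j)) := by group
          _ = ((descend (sigma n) n)⁻¹ * descend (sigma n) q) * (eta n c * eta n (c₁ j)) := by
              rw [e₁, ← mul_assoc _ _ (eta n (c₁ j)), e]; simp only [mul_assoc]
          _ = _ := by rw [e₂, map_mul, map_mul]; simp only [mul_assoc]
  · rw [(isDelta_A_iff n D).1 hD, ← halfTwist_eq_blockProd]
    -- The full twist is central, and is the image of `Δ` of type `B`, whose powers are those of
    -- `Δ ^ 2` up to a single factor `Δ`.
    have hcomm : Commute (halfTwist (sigma n) n ^ 2) (descend (sigma n) j) := by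
      refine commute_of_mem_closure ?_ (descend_mem_closure _ j)
      rintro _ ⟨i, hi, rfl⟩
      have hi : i < j := hi
      exact (isBraidSeq_sigma n).commute_halfTwist_sq (by omega)
    refine ⟨j, hj, blockProd (tau n) (2 * · + 1) n ^ z, ?_, ?_⟩
    · have hmod : z = 2 * (z / 2) + z % 2 := (Int.mul_ediv_add_emod z 2).symm
      have h3 : blockProd (tau n) (2 * · + 1) n ^ (z % 2) ∈ XP (typeB n) ^ K₃ := by
        rcases Int.emod_two_eq_zero_or_one z with h | h
        · rw [h, zpow_zero]
          exact Set.one_mem_pow h1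
        · rw [h, zpow_one]
          exact hK₃
      rw [hmod, zpow_add, zpow_mul]
      refine hmono (by omega : 1 + K₃ ≤ _) ?_
      rw [pow_add, pow_one]
      refine Set.mul_mem_mul (.inr ⟨_, (isDelta_B_iff n _).2 rfl, z / 2, ?_⟩) h3
      norm_cast
    · rw [map_zpow, eta_blockProd n le_rfl]
      exact (hcomm.zpow_left z).eq

theorem eta_mem_pow {k : ℕ} {b : ArtinB n} (hb : b ∈ XP (typeB n) ^ k) :
    eta n b ∈ XP (CoxeterMatrix.A n) ^ k := by
  have h : eta n '' (XP (typeB n) ^ k) ⊆ XP (CoxeterMatrix.A n) ^ k := by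
    rw [Set.image_pow]
    refine Set.pow_subset_pow_left ?_
    rintro _ ⟨c, hc, rfl⟩
    exact eta_mem_XP hc
  exact h ⟨b, hb, rfl⟩

/-- The word length of `b` is at most a constant times that of `eta n b`. -/
theorem exists_forall_mem_pow_mul_of_eta_mem_pow (hn : 2 ≤ n) :
    ∃ K : ℕ, 1 ≤ K ∧ ∀ (k : ℕ) (b : ArtinB n), eta n b ∈ XP (CoxeterMatrix.A n) ^ k →
      b ∈ XP (typeB n) ^ (K * k) := by
  obtain ⟨K, hK, h⟩ := exists_forall_XP_mul_descend hn
  refine ⟨K, hK, fun k b hb => ?_⟩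
  have key : ∀ (k : ℕ) (g : ArtinA n), g ∈ XP (CoxeterMatrix.A n) ^ k →
      ∃ q ≤ n, ∃ c ∈ XP (typeB n) ^ (K * k), g = descend (sigma n) q * eta n c := by
    intro k
    induction k with
    | zero =>
      intro g hg
      rw [pow_zero, Set.mem_one] at hg
      exact ⟨0, Nat.zero_le n, 1, by simp, by simp [hg, descend]⟩
    | succ k ih =>
      intro g hg
      rw [pow_succ'] at hg
      obtain ⟨y, hy, g, hg, rfl⟩ := hg
      obtain ⟨q, hq, c, hc, rfl⟩ := ih g hg
      obtain ⟨p, hp, d, hd, e⟩ := h y hy q hq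
      refine ⟨p, hp, d * c, ?_, ?_⟩
      · rw [Nat.mul_succ, add_comm, pow_add]
        exact Set.mul_mem_mul hd hc
      · change y * (descend (sigma n) q * eta n c) = _
        rw [← mul_assoc, e, map_mul, mul_assoc]
  obtain ⟨q, hq, c, hc, e⟩ := key k _ hb
  have h0 := eta_mem_onePure b
  rw [e] at h0
  obtain rfl := eq_zero_of_descend_mul_mem_onePure hq h0
  rw [descend, one_mul] at e
  rwa [eta_injective e]

/-- Each element is within distance `n` of the image of `eta`, since `descend j` is a product of
`j ≤ n` generators. -/
theorem exists_edist_eta_le (hn : 2 ≤ n) (z : ArtinA n) :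
    ∃ b : ArtinB n, (SimpleGraph.mulCayley (XP (CoxeterMatrix.A n))).edist z (eta n b) ≤ n := by
  obtain ⟨q, hq, c, h⟩ := exists_mul_descend_eq_top z⁻¹ (Nat.zero_le n)
  rw [descend, mul_one] at h
  refine ⟨c⁻¹, (edist_mulCayley_le_iff (one_mem_XP hn id) fun x hx => inv_mem_XP hx).2 ?_⟩
  rw [h, mul_assoc, ← map_mul, mul_inv_cancel, map_one, mul_one]
  suffices h : descend (sigma n) q ∈ XP (CoxeterMatrix.A n) ^ q from
    Set.pow_right_monotone (one_mem_XP hn id) hq h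
  clear h
  induction q with
  | zero => simp [descend]
  | succ q ih =>
    rw [pow_succ', descend_succ]
    refine Set.mul_mem_mul ?_ (ih (by omega))
    rw [sigma, genSeq, dif_pos (by omega)]
    exact gen_mem_XP hn id _

theorem connected_mulCayley_XP {M : CoxeterMatrix (Fin n)} (hn : 2 ≤ n)
    (hM : ∀ {I}, IsProperIrreducible (CoxeterMatrix.A n) I → IsProperIrreducible M I) :
    (SimpleGraph.mulCayley (XP M)).Connected :=
  connected_mulCayley (one_mem_XP hn hM) (fun _ hx => inv_mem_XP hx)
    (exists_mem_pow_of_closure_eq_top (fun _ hx => inv_mem_XP hx) (closure_XP hn hM))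

theorem isQuasiIsometry_eta (hn : 2 ≤ n) :
    IsQuasiIsometry (SimpleGraph.mulCayley (XP (typeB n)))
      (SimpleGraph.mulCayley (XP (CoxeterMatrix.A n))) (eta n) := by
  have hconB := connected_mulCayley_XP hn (M := typeB n) isProperIrreducible_B_iff.2
  have hconA := connected_mulCayley_XP hn (M := CoxeterMatrix.A n) id
  have hA : ∀ {x y : ArtinA n} {k : ℕ},
      (SimpleGraph.mulCayley (XP (CoxeterMatrix.A n))).edist x y ≤ k ↔
        x⁻¹ * y ∈ XP (CoxeterMatrix.A n) ^ k :=
    edist_mulCayley_le_iff (one_mem_XP hn id) fun x hx => inv_mem_XP hx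
  have hB : ∀ {x y : ArtinB n} {k : ℕ}, (SimpleGraph.mulCayley (XP (typeB n))).edist x y ≤ k ↔
      x⁻¹ * y ∈ XP (typeB n) ^ k :=
    edist_mulCayley_le_iff (one_mem_XP (M := typeB n) hn isProperIrreducible_B_iff.2)
      fun x hx => inv_mem_XP hx
  obtain ⟨K, hK, h⟩ := exists_forall_mem_pow_mul_of_eta_mem_pow hn
  refine ⟨K, n, hK, fun x y => ?_, fun x y => ?_, fun z => exists_edist_eta_le hn z⟩
  · obtain ⟨k, hk⟩ := ENat.ne_top_iff_exists.1
      (SimpleGraph.edist_ne_top_iff_reachable.2 (hconB.preconnected x y))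
    have h1 := eta_mem_pow (hB.1 hk.ge)
    rw [map_mul, map_inv, ← hA] at h1
    rw [← hk]
    refine h1.trans ?_
    norm_cast
    nlinarith
  · obtain ⟨k, hk⟩ := ENat.ne_top_iff_exists.1
      (SimpleGraph.edist_ne_top_iff_reachable.2 (hconA.preconnected (eta n x) (eta n y)))
    have h1 := hA.1 hk.ge
    rw [← map_inv, ← map_mul] at h1
    have h2 := hB.2 (h k _ h1)
    rw [← hk]
    refine h2.trans ?_
    norm_cast
    nlinarith

end QuasiIsometry

end ArtinTits

theorem propositionP (n : ℕ) (hn : 3 ≤ n) :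
    Function.Injective (ArtinTits.eta n) ∧
    (ArtinTits.eta n).range = ArtinTits.onePure n ∧
    (SimpleGraph.mulCayley (ArtinTits.XP (ArtinTits.typeB n))).Connected ∧
    (SimpleGraph.mulCayley (ArtinTits.XP (CoxeterMatrix.A n))).Connected ∧
    ArtinTits.IsQuasiIsometry
      (SimpleGraph.mulCayley (ArtinTits.XP (ArtinTits.typeB n)))
      (SimpleGraph.mulCayley (ArtinTits.XP (CoxeterMatrix.A n)))
      (ArtinTits.eta n) :=
  ⟨ArtinTits.eta_injective, ArtinTits.range_eta,
    ArtinTits.connected_mulCayley_XP (by omega) ArtinTits.isProperIrreducible_B_iff.2,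
    ArtinTits.connected_mulCayley_XP (by omega) id,
    ArtinTits.isQuasiIsometry_eta (by omega)⟩
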